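/- Let $\mathcal P=\langle x\mid x=x^2\rangle$. A planar $(x^m,x^n)$-picture over $\mathcal P$ is built from $m$ vertical wires by attaching finitely many transistors, each of which either splits one wire into two (an $(x,x^2)$-transistor, or caret) or merges two adjacent wires into one (an $(x^2,x)$-transistor), and has $n$ wires at its bottom. Pictures are considered modulo isomorphism and modulo dipoles (a dipole is a transistor together with its mirror image attached, in order, to all of its bottom wires; it may be inserted and removed). Thompson's group $F$ is the group of planar $(x,x)$-pictures modulo dipoles under concatenation. Let $X_F$ be the cubical complex whose vertices are the planar $(x,*)$-pictures (one wire at the top, any number of wires at the bottom) modulo dipoles, with an $n$-cube for each way of attaching $n$ transistors to pairwise disjoint sets of consecutive bottom wires of a vertex; the base vertex $*$ is the picture without transistors, and $F$ acts by concatenation from above. A hyperplane $H$ is a class of edges under the equivalence relation generated by being opposite sides of a square, and its positive half-space $H^+$ is the component of the complement of $H$ that does not contain $*$. Positive half-spaces are ordered by $H_1^+\le H_2^+\iff H_2^+\subseteq H_1^+$. A profile of $X_F$ is a non-empty set $\mathcal H$ of positive half-spaces such that (1) every finite subset of $\mathcal H$ has non-empty intersection; (2) $\mathcal H$ has no maximal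 element; (3) if $H_1^+\in\mathcal H$ and $H_2^+\le H_1^+$, then $H_2^+\in\mathcal H$. The group $F$ acts on profiles: $g*\mathcal H$ is the unique profile cofinal with $\{gH^+ : H^+\in\mathcal H'\}$, for any $\mathcal H'$ that is cofinal with $\mathcal H$ and whose members are mapped by $g$ to positive half-spaces. Label the carets of the full infinite binary tree by finite binary strings: the root caret by the empty string, and the caret attached to the left (right) bottom wire of the caret $b$ by $b0$ ($b1$). For a caret $b$, let $H_b$ be the hyperplane crossing the edge from the picture formed by the carets labelled by proper prefixes of $b$ to the picture formed by these carets and $b$. Put $$\Delta_\infty=\{H_b^+ : b\in\{0,1\}^*\},\quad \Delta_L=\{H_{0^k}^+ : k\ge 0\},\quad \Delta_R=\{H_{1^k}^+ : k\ge 0\},\quad \Delta_{L-R}=\Delta_L\cup\Delta_R .$$ **Theorem 5.1.** $\Delta_L$, $\Delta_R$, $\Delta_{L-R}$ and $\Delta_\infty$ are four distinct profiles of $X_F$, and a profile of $X_F$ is fixed by every element of $F$ if and only if it is one of these four. -/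

import Mathlib

namespace ThompsonProfile

/-! ### Planar pictures over the semigroup presentation `⟨x | x = x²⟩` -/

/-- The two kinds of transistors: `split` is an `(x, x²)`-transistor (one wire above, two below),
`merge` is an `(x², x)`-transistor (two wires above, one below). -/
inductive Kind
  | split
  | merge

/-- The number of wires attached to the top of a transistor. -/
def Kind.ins : Kind → ℕ
  | .split => 1
  | .merge => 2

/-- The number of wires attached to the bottom of a transistor. -/
def Kind.outs : Kind → ℕ
  | .split => 2
  | .merge => 1

/-- The kind of the transistor turned upside down. -/
def Kind.flip : Kind → Kind
  | .split => .merge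
  | .merge => .split

/-- A transistor attached below a row of parallel vertical wires, which are numbered `0, 1, 2, …`
from left to right: `pos` is the number of the leftmost wire that its top is attached to. -/
@[ext] structure Atom where
  kind : Kind
  pos : ℕ

/-- A planar picture, its transistors drawn at distinct heights, is recorded by the list of its
transistors read from top to bottom. -/
abbrev Word := List Atom

/-- `IsPicture m w n`: the word `w` describes a planar `(x^m, x^n)`-picture. -/
inductive IsPicture : ℕ → Word → ℕ → Prop
  | nil (n : ℕ) : IsPicture n [] n
  | cons (k : Kind) (l r : ℕ) {w : Word} {n : ℕ} :
      IsPicture (l + k.outs + r) w n → IsPicture (l + k.ins + r) (⟨k, l⟩ :: w) n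

/-- Planar `(x^m, x^n)`-pictures over `⟨x | x = x²⟩`, with an ordering of the transistors that
refines the vertical order (different orderings are identified by `Step.interchange` below). -/
@[ext] structure Picture (m n : ℕ) where
  word : Word
  valid : IsPicture m word n

/-- Elementary moves between words.
`interchange`: two consecutive transistors that have no wire in common (the first one to the left
of the second one) trade heights; this does not change the planar picture up to isomorphism.
`dipole`: a transistor, followed by its mirror image attached in order to all of its bottom wires,
is removed. -/
inductive Step : Word → Word → Prop
  | interchange (u v : Word) (k k' : Kind) (i j : ℕ) :
      Step (u ++ ⟨k, i⟩ :: ⟨k', i + k.outs + j⟩ :: v) (u ++ ⟨k', i + k.ins + j⟩ :: ⟨k, i⟩ :: v)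
  | dipole (u v : Word) (k : Kind) (i : ℕ) :
      Step (u ++ ⟨k, i⟩ :: ⟨k.flip, i⟩ :: v) (u ++ v)

/-- Equality of planar pictures modulo dipoles: the equivalence relation generated by
isomorphism and by the insertion and removal of dipoles. -/
def dipoleSetoid (m n : ℕ) : Setoid (Picture m n) :=
  Relation.EqvGen.setoid fun P Q => Step P.word Q.word

/-- Planar `(x^m, x^n)`-pictures modulo dipoles. Each class contains exactly one reduced picture
up to isomorphism. -/
def Diagram (m n : ℕ) : Type := Quotient (dipoleSetoid m n)

/-- The class of a picture modulo dipoles. -/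
def Diagram.mk {m n : ℕ} (P : Picture m n) : Diagram m n := Quotient.mk (dipoleSetoid m n) P

theorem IsPicture.append {m n p : ℕ} {u v : Word} (hu : IsPicture m u n) (hv : IsPicture n v p) :
    IsPicture m (u ++ v) p := by
  induction hu with
  | nil n => simpa using hv
  | cons k l r _ ih => exact IsPicture.cons k l r (ih hv)

/-- The concatenation `P ∘ Q`, with `P` on top. -/
def Picture.comp {m n p : ℕ} (P : Picture m n) (Q : Picture n p) : Picture m p :=
  ⟨P.word ++ Q.word, P.valid.append Q.valid⟩

theorem Step.append_left {u v : Word} (h : Step u v) (w : Word) : Step (w ++ u) (w ++ v) := by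
  cases h with
  | interchange a b k k' i j =>
    simpa only [List.append_assoc] using Step.interchange (w ++ a) b k k' i j
  | dipole a b k i => simpa only [List.append_assoc] using Step.dipole (w ++ a) b k i

theorem Step.append_right {u v : Word} (h : Step u v) (w : Word) : Step (u ++ w) (v ++ w) := by
  cases h with
  | interchange a b k k' i j =>
    simpa only [List.append_assoc, List.cons_append] using Step.interchange a (b ++ w) k k' i j
  | dipole a b k i =>
    simpa only [List.append_assoc, List.cons_append] using Step.dipole a (b ++ w) k i

theorem comp_congr_left {m n p : ℕ} {P P' : Picture m n} (h : dipoleSetoid m n P P')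
    (Q : Picture n p) : dipoleSetoid m p (P.comp Q) (P'.comp Q) := by
  induction h with
  | rel _ _ h => exact .rel _ _ (h.append_right _)
  | refl _ => exact .refl _
  | symm _ _ _ ih => exact .symm _ _ ih
  | trans _ _ _ _ _ ih₁ ih₂ => exact .trans _ _ _ ih₁ ih₂

theorem comp_congr_right {m n p : ℕ} (P : Picture m n) {Q Q' : Picture n p}
    (h : dipoleSetoid n p Q Q') : dipoleSetoid m p (P.comp Q) (P.comp Q') := by
  induction h with
  | rel _ _ h => exact .rel _ _ (h.append_left _)
  | refl _ => exact .refl _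
  | symm _ _ _ ih => exact .symm _ _ ih
  | trans _ _ _ _ _ ih₁ ih₂ => exact .trans _ _ _ ih₁ ih₂

/-- Concatenation of pictures modulo dipoles. -/
def Diagram.comp {m n p : ℕ} (a : Diagram m n) (b : Diagram n p) : Diagram m p :=
  Quotient.map₂ Picture.comp
    (fun _ _ h _ _ h' => (comp_congr_left h _).trans _ _ _ (comp_congr_right _ h')) a b

theorem Diagram.mk_comp {m n p : ℕ} (P : Picture m n) (Q : Picture n p) :
    (Diagram.mk P).comp (Diagram.mk Q) = Diagram.mk (P.comp Q) := rfl

theorem Diagram.comp_assoc {m n p q : ℕ} (a : Diagram m n) (b : Diagram n p) (c : Diagram p q) :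
    (a.comp b).comp c = a.comp (b.comp c) := by
  induction a using Quotient.ind
  induction b using Quotient.ind
  induction c using Quotient.ind
  exact congrArg Diagram.mk (Picture.ext (List.append_assoc _ _ _))

/-- The picture without transistors. -/
def Picture.id (n : ℕ) : Picture n n := ⟨[], .nil n⟩

theorem Diagram.id_comp {m n : ℕ} (a : Diagram m n) :
    (Diagram.mk (Picture.id m)).comp a = a := by
  induction a using Quotient.ind
  rfl

theorem Diagram.comp_id {m n : ℕ} (a : Diagram m n) :
    a.comp (Diagram.mk (Picture.id n)) = a := by
  induction a using Quotient.ind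
  exact congrArg Diagram.mk (Picture.ext (List.append_nil _))

@[simp] theorem Kind.flip_flip (k : Kind) : k.flip.flip = k := by cases k <;> rfl
@[simp] theorem Kind.flip_ins (k : Kind) : k.flip.ins = k.outs := by cases k <;> rfl
@[simp] theorem Kind.flip_outs (k : Kind) : k.flip.outs = k.ins := by cases k <;> rfl

/-- The mirror image of a transistor in a horizontal line. -/
def Atom.flip (a : Atom) : Atom := ⟨a.kind.flip, a.pos⟩

/-- The mirror image of a word in a horizontal line. -/
def Word.flip (w : Word) : Word := (w.map Atom.flip).reverse

theorem Word.flip_flip (w : Word) : Word.flip (Word.flip w) = w := by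
  have h : Atom.flip ∘ Atom.flip = id := by
    funext a
    exact Atom.ext (Kind.flip_flip _) rfl
  simp [Word.flip, h]

theorem IsPicture.flip {m n : ℕ} {w : Word} (h : IsPicture m w n) :
    IsPicture n (Word.flip w) m := by
  induction h with
  | nil n => exact .nil n
  | @cons k l r w n _ ih =>
    have h1 : IsPicture (l + k.flip.ins + r) [⟨k.flip, l⟩] (l + k.flip.outs + r) :=
      .cons k.flip l r (.nil _)
    rw [Kind.flip_ins, Kind.flip_outs] at h1
    have := ih.append h1
    simpa [Word.flip, Atom.flip] using this

/-- The mirror image of a picture in a horizontal line. -/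
def Picture.flip {m n : ℕ} (P : Picture m n) : Picture n m := ⟨Word.flip P.word, P.valid.flip⟩

theorem Picture.flip_flip {m n : ℕ} (P : Picture m n) : P.flip.flip = P :=
  Picture.ext (Word.flip_flip _)

theorem flip_congr {m n : ℕ} {P Q : Picture m n} (h : dipoleSetoid m n P Q) :
    dipoleSetoid n m P.flip Q.flip := by
  induction h with
  | rel P Q h =>
    obtain ⟨u, hu⟩ := P
    obtain ⟨v, hv⟩ := Q
    cases h with
    | interchange a b k k' i j =>
      refine .symm _ _ (.rel _ _ ?_)
      have := Step.interchange (Word.flip b) (Word.flip a) k.flip k'.flip i j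
      simpa [Picture.flip, Word.flip, Atom.flip] using this
    | dipole a b k i =>
      refine .rel _ _ ?_
      have := Step.dipole (Word.flip b) (Word.flip a) k i
      simpa [Picture.flip, Word.flip, Atom.flip] using this
  | refl _ => exact .refl _
  | symm _ _ _ ih => exact .symm _ _ ih
  | trans _ _ _ _ _ ih₁ ih₂ => exact .trans _ _ _ ih₁ ih₂

theorem comp_flip {m n : ℕ} (P : Picture m n) :
    dipoleSetoid m m (P.comp P.flip) (Picture.id m) := by
  obtain ⟨w, h⟩ := P
  induction h with
  | nil n => exact .refl _
  | @cons k l r w n h ih =>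
    have h1 : IsPicture (l + k.ins + r) [⟨k, l⟩] (l + k.outs + r) := .cons k l r (.nil _)
    let T : Picture (l + k.ins + r) (l + k.outs + r) := ⟨_, h1⟩
    have h2 := comp_congr_left (comp_congr_right T ih) T.flip
    have h3 : dipoleSetoid _ _ ((T.comp (Picture.id _)).comp T.flip) (Picture.id _) :=
      .rel _ _ (Step.dipole [] [] k l)
    have h4 := Setoid.trans' _ h2 h3
    convert h4 using 1
    refine Picture.ext ?_
    simp [Picture.comp, Picture.flip, Word.flip, T]

/-- Thompson's group `F`: planar `(x, x)`-pictures over `⟨x | x = x²⟩` modulo dipoles, under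
concatenation. -/
abbrev F : Type := Diagram 1 1

instance : Group F where
  mul a b := Diagram.comp a b
  one := Diagram.mk (Picture.id 1)
  inv a := Quotient.map Picture.flip (fun _ _ h => flip_congr h) a
  mul_assoc a b c := Diagram.comp_assoc a b c
  one_mul a := Diagram.id_comp a
  mul_one a := Diagram.comp_id a
  inv_mul_cancel a := by
    induction a using Quotient.ind with
    | _ P =>
      have h := comp_flip P.flip
      rw [Picture.flip_flip] at h
      exact Quotient.sound h

/-! ### The cubical complex `X_F`, its hyperplanes and half-spaces

Only vertices, edges and squares are needed: they determine the hyperplanes, and a half-space is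
determined by the vertices in it. -/

/-- The vertices of `X_F`: planar `(x, *)`-pictures modulo dipoles (that is, reduced planar
`(x, *)`-pictures), where the number of bottom wires is arbitrary. -/
abbrev Vertex : Type := Σ n : ℕ, Diagram 1 n

/-- The vertex represented by a word. -/
def vertex {w : Word} {n : ℕ} (h : IsPicture 1 w n) : Vertex := ⟨n, Diagram.mk ⟨w, h⟩⟩

/-- The vertex without transistors. -/
def base : Vertex := vertex (IsPicture.nil 1)

/-- `F` acts on the vertices by concatenation from above. -/
instance : MulAction F Vertex where
  smul g v := ⟨v.1, Diagram.comp g v.2⟩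
  one_smul v := Sigma.ext rfl (heq_of_eq (Diagram.id_comp v.2))
  mul_smul g h v := Sigma.ext rfl (heq_of_eq (Diagram.comp_assoc g h v.2))

/-- `v'` is obtained from `v` by attaching one transistor to bottom wires of `v`. -/
inductive Attach : Vertex → Vertex → Prop
  | mk {w : Word} {a : Atom} {n n' : ℕ} (h : IsPicture 1 w n) (h' : IsPicture 1 (w ++ [a]) n') :
      Attach (vertex h) (vertex h')

theorem IsPicture.width_unique {m n n' : ℕ} {w : Word} (h : IsPicture m w n)
    (h' : IsPicture m w n') : n = n' := by
  induction h with
  | nil n => cases h'; rfl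
  | cons k l r _ ih =>
    generalize hm : l + k.ins + r = m at h'
    cases h' with
    | cons _ _ r' h' =>
      obtain rfl : r = r' := by omega
      exact ih h'

theorem IsPicture.of_nil {m n : ℕ} (h : IsPicture m [] n) : m = n := by
  generalize hw : ([] : Word) = w at h
  cases h with
  | nil _ => rfl
  | cons => cases hw

theorem IsPicture.of_cons {m n : ℕ} {a : Atom} {w : Word} (h : IsPicture m (a :: w) n) :
    ∃ r, m = a.pos + a.kind.ins + r ∧ IsPicture (a.pos + a.kind.outs + r) w n := by
  generalize hw : a :: w = w' at h
  cases h with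
  | nil _ => cases hw
  | cons k l r h =>
    obtain ⟨rfl, rfl⟩ := List.cons.inj hw
    exact ⟨r, rfl, h⟩

theorem IsPicture.of_append {m n : ℕ} {u v : Word} (h : IsPicture m (u ++ v) n) :
    ∃ p, IsPicture m u p ∧ IsPicture p v n := by
  induction u generalizing m with
  | nil => exact ⟨m, .nil m, h⟩
  | cons a u ih =>
    cases h with
    | cons k l r h =>
      obtain ⟨p, hp, hp'⟩ := ih h
      exact ⟨p, .cons k l r hp, hp'⟩

theorem Attach.width_ne {v v' : Vertex} (h : Attach v v') : v.1 ≠ v'.1 := by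
  cases h with
  | @mk w a n n' h h' =>
    obtain ⟨p, hp, ha⟩ := h'.of_append
    obtain rfl := h.width_unique hp
    change n ≠ n'
    obtain ⟨r, rfl, h2⟩ := ha.of_cons
    have h3 := h2.of_nil
    obtain ⟨k, l⟩ := a
    cases k <;> simp only [Kind.ins, Kind.outs] at h3 ⊢ <;> omega

/-- The 1-skeleton of `X_F`. -/
def skeleton : SimpleGraph Vertex where
  Adj v v' := Attach v v' ∨ Attach v' v
  symm := ⟨fun _ _ h => h.symm⟩
  loopless := ⟨fun _ h => by rcases h with h | h <;> exact h.width_ne rfl⟩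

/-- Two edges of `X_F` that are opposite sides of a square. The corners of a square are a vertex
`w`, the two vertices which arise by attaching one of two transistors (of kinds `k`, `k'`, the
first to the left of the second) to disjoint sets of bottom wires of `w`, and the vertex
which arises by attaching both. -/
inductive Opposite : Sym2 Vertex → Sym2 Vertex → Prop
  | left {w : Word} {k k' : Kind} {i j n₀ n₁ n₂ n₃ : ℕ} (h₀ : IsPicture 1 w n₀)
      (h₁ : IsPicture 1 (w ++ [⟨k, i⟩]) n₁)
      (h₂ : IsPicture 1 (w ++ [⟨k', i + k.ins + j⟩]) n₂)
      (h₃ : IsPicture 1 (w ++ [⟨k, i⟩, ⟨k', i + k.outs + j⟩]) n₃) :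
      Opposite s(vertex h₀, vertex h₁) s(vertex h₂, vertex h₃)
  | right {w : Word} {k k' : Kind} {i j n₀ n₁ n₂ n₃ : ℕ} (h₀ : IsPicture 1 w n₀)
      (h₁ : IsPicture 1 (w ++ [⟨k, i⟩]) n₁)
      (h₂ : IsPicture 1 (w ++ [⟨k', i + k.ins + j⟩]) n₂)
      (h₃ : IsPicture 1 (w ++ [⟨k, i⟩, ⟨k', i + k.outs + j⟩]) n₃) :
      Opposite s(vertex h₀, vertex h₂) s(vertex h₁, vertex h₃)

/-- The (combinatorial) hyperplane crossing the edge `e`: its square equivalence class. -/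
def hyperplane (e : Sym2 Vertex) : Set (Sym2 Vertex) := {e' | Relation.EqvGen Opposite e e'}

/-- The positive half-space of the hyperplane crossing `e`: the vertices that cannot be joined to
the base vertex by an edge-path which does not cross the hyperplane. -/
def posHalf (e : Sym2 Vertex) : Set Vertex :=
  {v | ¬ (skeleton.deleteEdges (hyperplane e)).Reachable base v}

/-- The positive half-spaces of `X_F`. -/
def IsPosHalfSpace (A : Set Vertex) : Prop := ∃ e ∈ skeleton.edgeSet, A = posHalf e

/-! ### Profiles -/

/-- A profile of `X_F`. Positive half-spaces are ordered by reverse inclusion. -/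
@[ext] structure Profile where
  /-- The positive half-spaces in the profile. -/
  carrier : Set (Set Vertex)
  pos : ∀ A ∈ carrier, IsPosHalfSpace A
  nonempty : carrier.Nonempty
  inter : ∀ s : Set (Set Vertex), s.Finite → s ⊆ carrier → (⋂₀ s).Nonempty
  no_max : ∀ A ∈ carrier, ∃ B ∈ carrier, B ⊂ A
  lower : ∀ A ∈ carrier, ∀ B, IsPosHalfSpace B → A ⊆ B → B ∈ carrier

/-- Two collections of half-spaces are cofinal (for the order by reverse inclusion). -/
def Cofinal (𝓗 𝓗' : Set (Set Vertex)) : Prop :=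
  (∀ A ∈ 𝓗, ∃ B ∈ 𝓗', B ⊆ A) ∧ ∀ B ∈ 𝓗', ∃ A ∈ 𝓗, A ⊆ B

/-- The translate of a set of vertices. -/
def translate (g : F) (A : Set Vertex) : Set Vertex := (fun v => g • v) '' A

theorem translate_mono (g : F) {A B : Set Vertex} (h : A ⊆ B) : translate g A ⊆ translate g B :=
  Set.image_mono h

theorem translate_ssubset (g : F) {A B : Set Vertex} (h : A ⊂ B) :
    translate g A ⊂ translate g B :=
  ⟨translate_mono g h.1, fun h' => h.2 ((Set.image_subset_image_iff (MulAction.injective g)).1 h')⟩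

theorem translate_mul (g h : F) (A : Set Vertex) :
    translate (g * h) A = translate g (translate h A) := by
  simp [translate, Set.image_image, mul_smul]

theorem translate_one (A : Set Vertex) : translate 1 A = A := by simp [translate]

theorem vertex_congr {w w' : Word} {n : ℕ} (h : IsPicture 1 w n) (h' : IsPicture 1 w' n)
    (e : w = w') : vertex h = vertex h' := by
  subst e; rfl

theorem attach_smul (g : F) {v v' : Vertex} (h : Attach v v') : Attach (g • v) (g • v') := by
  induction g using Quotient.ind with
  | _ P =>
    cases h with
    | @mk w a n n' h h' =>
      have c := P.valid.append h'
      rw [← List.append_assoc] at c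
      have key := Attach.mk (P.valid.append h) c
      rw [vertex_congr c (P.valid.append h') (List.append_assoc _ _ _)] at key
      exact key

theorem adj_smul (g : F) {v v' : Vertex} (h : skeleton.Adj v v') :
    skeleton.Adj (g • v) (g • v') :=
  h.imp (attach_smul g) (attach_smul g)

theorem opposite_smul (g : F) {e e' : Sym2 Vertex} (h : Opposite e e') :
    Opposite (e.map (g • ·)) (e'.map (g • ·)) := by
  induction g using Quotient.ind with
  | _ P =>
    cases h with
    | @left w k k' i j n₀ n₁ n₂ n₃ h₀ h₁ h₂ h₃ =>
      have c₁ := P.valid.append h₁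
      have c₂ := P.valid.append h₂
      have c₃ := P.valid.append h₃
      rw [← List.append_assoc] at c₁ c₂ c₃
      have key := Opposite.left (P.valid.append h₀) c₁ c₂ c₃
      rw [vertex_congr c₁ (P.valid.append h₁) (List.append_assoc _ _ _),
        vertex_congr c₂ (P.valid.append h₂) (List.append_assoc _ _ _),
        vertex_congr c₃ (P.valid.append h₃) (List.append_assoc _ _ _)] at key
      exact key
    | @right w k k' i j n₀ n₁ n₂ n₃ h₀ h₁ h₂ h₃ =>
      have c₁ := P.valid.append h₁
      have c₂ := P.valid.append h₂
      have c₃ := P.valid.append h₃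
      rw [← List.append_assoc] at c₁ c₂ c₃
      have key := Opposite.right (P.valid.append h₀) c₁ c₂ c₃
      rw [vertex_congr c₁ (P.valid.append h₁) (List.append_assoc _ _ _),
        vertex_congr c₂ (P.valid.append h₂) (List.append_assoc _ _ _),
        vertex_congr c₃ (P.valid.append h₃) (List.append_assoc _ _ _)] at key
      exact key

theorem hyperplane_smul (g : F) {e e' : Sym2 Vertex} (h : e' ∈ hyperplane e) :
    e'.map (g • ·) ∈ hyperplane (e.map (g • ·)) := by
  induction h with
  | rel _ _ h => exact .rel _ _ (opposite_smul g h)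
  | refl _ => exact .refl _
  | symm _ _ _ ih => exact .symm _ _ ih
  | trans _ _ _ _ _ ih₁ ih₂ => exact .trans _ _ _ ih₁ ih₂

theorem map_inv_map (g : F) (e : Sym2 Vertex) : (e.map (g • ·)).map (g⁻¹ • ·) = e := by
  induction e using Sym2.ind with
  | _ a b => simp only [Sym2.map_mk, inv_smul_smul]

theorem reachable_smul (g : F) {e : Sym2 Vertex} {u v : Vertex}
    (h : (skeleton.deleteEdges (hyperplane e)).Reachable u v) :
    (skeleton.deleteEdges (hyperplane (e.map (g • ·)))).Reachable (g • u) (g • v) := by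
  refine h.map (G' := skeleton.deleteEdges (hyperplane (e.map (g • ·)))) ⟨fun v => g • v, ?_⟩
  intro a b hab
  rw [SimpleGraph.deleteEdges_adj] at hab ⊢
  refine ⟨adj_smul g hab.1, fun hmem => hab.2 ?_⟩
  have := hyperplane_smul g⁻¹ hmem
  rw [map_inv_map] at this
  simpa using this

/-- A translate of a positive half-space is a positive half-space unless it contains the base
vertex. -/
theorem isPosHalfSpace_translate (g : F) {A : Set Vertex} (hA : IsPosHalfSpace A)
    (hb : g⁻¹ • base ∉ A) : IsPosHalfSpace (translate g A) := by
  obtain ⟨e, he, rfl⟩ := hA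
  refine ⟨e.map (g • ·), ?_, ?_⟩
  · induction e using Sym2.ind with
    | _ a b => exact adj_smul g he
  · have hb' := reachable_smul g (not_not.mp hb)
    rw [smul_inv_smul] at hb'
    ext v
    constructor
    · rintro ⟨v, hv, rfl⟩ hr
      apply hv
      have := reachable_smul g⁻¹ (hb'.trans hr)
      simpa only [map_inv_map, inv_smul_smul] using this
    · intro hv
      refine ⟨g⁻¹ • v, fun hr => hv ?_, smul_inv_smul _ _⟩
      have := reachable_smul g hr
      rw [smul_inv_smul] at this
      exact hb'.symm.trans this

theorem skeleton_preconnected_aux {w : Word} {n : ℕ} (h : IsPicture 1 w n) :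
    skeleton.Reachable base (vertex h) := by
  induction w using List.reverseRecOn generalizing n with
  | nil =>
    obtain rfl := h.of_nil
    exact .refl _
  | append_singleton w a ih =>
    obtain ⟨p, hp, _⟩ := h.of_append
    exact (ih hp).trans (SimpleGraph.Adj.reachable (Or.inl (Attach.mk hp h)))

theorem skeleton_reachable (v : Vertex) : skeleton.Reachable base v := by
  obtain ⟨n, d⟩ := v
  induction d using Quotient.ind with
  | _ P => exact skeleton_preconnected_aux P.valid

/-- Only finitely many positive half-spaces contain a given vertex. -/
theorem finite_posHalf (v : Vertex) : {A | IsPosHalfSpace A ∧ v ∈ A}.Finite := by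
  obtain ⟨p⟩ := skeleton_reachable v
  refine Set.Finite.subset ((List.finite_toSet p.edges).image posHalf) ?_
  rintro A ⟨⟨e, -, rfl⟩, hv⟩
  by_contra hcon
  apply hv
  refine ⟨p.toDeleteEdges _ fun f hf hfe => hcon ⟨f, hf, ?_⟩⟩
  have : hyperplane f = hyperplane e := by
    ext e'
    exact ⟨fun h => .trans _ _ _ hfe h, fun h => .trans _ _ _ (.symm _ _ hfe) h⟩
  simp only [posHalf, this]

theorem Profile.exists_avoid (P : Profile) {A : Set Vertex} (hA : A ∈ P.carrier) (v : Vertex) :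
    ∃ B ∈ P.carrier, B ⊆ A ∧ v ∉ B := by
  by_contra! hcon
  let s := {B ∈ P.carrier | B ⊆ A}
  have hs : s.Finite := (finite_posHalf v).subset fun B hB => ⟨P.pos B hB.1, hcon B hB.1 hB.2⟩
  obtain ⟨B, hB⟩ := hs.exists_minimal ⟨A, hA, subset_rfl⟩
  obtain ⟨C, hC, hCB⟩ := P.no_max B hB.1.1
  exact hCB.2 (hB.2 ⟨hC, hCB.1.trans hB.1.2⟩ hCB.1)

theorem Profile.exists_good (P : Profile) {A : Set Vertex} (hA : A ∈ P.carrier) (g : F) :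
    ∃ B ∈ P.carrier, B ⊆ A ∧ IsPosHalfSpace (translate g B) := by
  obtain ⟨B, hB, hBA, hv⟩ := P.exists_avoid hA (g⁻¹ • base)
  exact ⟨B, hB, hBA, isPosHalfSpace_translate g (P.pos B hB) hv⟩

/-- The profile `g * P`: all positive half-spaces that precede the translate by `g` of some
half-space of `P` whose translate is again positive. -/
def Profile.act (g : F) (P : Profile) : Profile where
  carrier := {B | IsPosHalfSpace B ∧
    ∃ A ∈ P.carrier, IsPosHalfSpace (translate g A) ∧ translate g A ⊆ B}
  pos _ h := h.1
  nonempty := by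
    obtain ⟨A, hA⟩ := P.nonempty
    obtain ⟨B, hB, -, h⟩ := P.exists_good hA g
    exact ⟨_, h, B, hB, h, subset_rfl⟩
  inter s hs hsub := by
    have h : ∀ B ∈ s, ∃ A ∈ P.carrier, translate g A ⊆ B := fun B hB =>
      let ⟨_, A, hA, _, hAB⟩ := hsub hB
      ⟨A, hA, hAB⟩
    choose! f hf hf' using h
    obtain ⟨v, hv⟩ := P.inter (f '' s) (hs.image f) (by rintro _ ⟨B, hB, rfl⟩; exact hf B hB)
    exact ⟨g • v, fun B hB => hf' B hB ⟨v, hv _ ⟨B, hB, rfl⟩, rfl⟩⟩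
  no_max := by
    rintro B ⟨-, A, hA, -, hAB⟩
    obtain ⟨C, hC, hCA⟩ := P.no_max A hA
    obtain ⟨D, hD, hDC, hg⟩ := P.exists_good hC g
    exact ⟨_, ⟨hg, D, hD, hg, subset_rfl⟩,
      (translate_ssubset g (hDC.trans_ssubset hCA)).trans_subset hAB⟩
  lower := by
    rintro B ⟨-, A, hA, hg, hAB⟩ C hC hBC
    exact ⟨hC, A, hA, hg, hAB.trans hBC⟩

/-- The action of `F` on profiles. -/
instance : MulAction F Profile where
  smul := Profile.act
  one_smul P := by
    refine Profile.ext (Set.ext fun B => ⟨?_, fun hB => ?_⟩)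
    · rintro ⟨hB, A, hA, -, hAB⟩
      rw [translate_one] at hAB
      exact P.lower A hA B hB hAB
    · exact ⟨P.pos B hB, B, hB, by rw [translate_one]; exact P.pos B hB,
        by rw [translate_one]⟩
  mul_smul g h P := by
    refine Profile.ext (Set.ext fun B => ⟨?_, ?_⟩)
    · rintro ⟨hB, A, hA, -, hAB⟩
      obtain ⟨C, hC, hCA, hCh⟩ := P.exists_good hA h
      obtain ⟨D, hD, hDC, hDg⟩ := (P.act h).exists_good ⟨hCh, C, hC, hCh, subset_rfl⟩ g
      refine ⟨hB, D, hD, hDg, (translate_mono g hDC).trans ?_⟩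
      rw [← translate_mul]
      exact (translate_mono _ hCA).trans hAB
    · rintro ⟨hB, D, ⟨-, A, hA, -, hAD⟩, -, hDB⟩
      obtain ⟨C, hC, hCA, hCg⟩ := P.exists_good hA (g * h)
      refine ⟨hB, C, hC, hCg, (translate_mono _ hCA).trans ?_⟩
      rw [translate_mul]
      exact (translate_mono g hAD).trans hDB

/-- `g • P` is the unique profile that is cofinal with the translate by `g` of any collection
`𝓗` which is cofinal with `P` and which `g` maps to positive half-spaces. -/
theorem smul_eq_iff_cofinal (g : F) (P Q : Profile) (𝓗 : Set (Set Vertex))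
    (hP : Cofinal 𝓗 P.carrier) (hg : ∀ A ∈ 𝓗, IsPosHalfSpace (translate g A)) :
    g • P = Q ↔ Cofinal (translate g '' 𝓗) Q.carrier := by
  have key : ∀ B, B ∈ (g • P).carrier ↔ IsPosHalfSpace B ∧ ∃ A ∈ 𝓗, translate g A ⊆ B := by
    intro B
    constructor
    · rintro ⟨hB, A, hA, -, hAB⟩
      obtain ⟨C, hC, hCA⟩ := hP.2 A hA
      exact ⟨hB, C, hC, (translate_mono g hCA).trans hAB⟩
    · rintro ⟨hB, A, hA, hAB⟩
      obtain ⟨C, hC, hCA⟩ := hP.1 A hA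
      obtain ⟨D, hD, hDC, hDg⟩ := P.exists_good hC g
      exact ⟨hB, D, hD, hDg, (translate_mono g (hDC.trans hCA)).trans hAB⟩
  constructor
  · rintro rfl
    refine ⟨?_, fun B hB => ?_⟩
    · rintro _ ⟨A, hA, rfl⟩
      exact ⟨_, (key _).2 ⟨hg A hA, A, hA, subset_rfl⟩, subset_rfl⟩
    · obtain ⟨-, A, hA, hAB⟩ := (key B).1 hB
      exact ⟨_, ⟨A, hA, rfl⟩, hAB⟩
  · rintro ⟨h1, h2⟩
    refine Profile.ext (Set.ext fun B => (key B).trans ⟨?_, fun hB => ?_⟩)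
    · rintro ⟨hB, A, hA, hAB⟩
      obtain ⟨C, hC, hCA⟩ := h1 _ ⟨A, hA, rfl⟩
      exact Q.lower C hC B hB (hCA.trans hAB)
    · obtain ⟨_, ⟨A, hA, rfl⟩, hAB⟩ := h2 B hB
      exact ⟨Q.pos B hB, A, hA, hAB⟩

/-! ### Profiles given by infinite binary trees

The `(x, x²)`-transistors (carets) of the full infinite binary tree are labelled by binary
strings: the root by the empty string, and the transistor attached to the left (right) bottom wire
of the transistor `b` by `b` followed by `false` (`true`). -/

/-- The transistors strictly above the transistor `b`, read from top to bottom, where the root is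
attached to wire number `p`. -/
def pathWord (p : ℕ) : List Bool → Word
  | [] => []
  | c :: b => ⟨.split, p⟩ :: pathWord (p + c.toNat) b

/-- The transistors above the transistor `b`, followed by `b` itself, which is attached to wire
number `b.count true`. -/
def caretWord (b : List Bool) : Word := pathWord 0 b ++ [⟨.split, b.count true⟩]

theorem isPicture_pathWord_aux (p r : ℕ) (b : List Bool) :
    ∃ s, r + b.length = b.count true + s ∧
      IsPicture (p + 1 + r) (pathWord p b) (p + b.count true + 1 + s) := by
  induction b generalizing p r with
  | nil => exact ⟨r, by simp, .nil _⟩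
  | cons c b ih =>
    cases c with
    | false =>
      obtain ⟨s, hs, h⟩ := ih p (r + 1)
      refine ⟨s, ?_, IsPicture.cons .split p r ?_⟩
      · simp only [List.length_cons, List.count_cons_of_ne, ne_eq, Bool.false_eq_true,
          not_false_eq_true]
        omega
      · have e : p + Kind.split.outs + r = p + 1 + (r + 1) := by simp only [Kind.outs]; omega
        rw [e]
        simpa using h
    | true =>
      obtain ⟨s, hs, h⟩ := ih (p + 1) r
      refine ⟨s, ?_, IsPicture.cons .split p r ?_⟩
      · simp only [List.length_cons, List.count_cons_self]
        omega
      · have e : p + (true :: b).count true = p + 1 + b.count true := by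
          simp only [List.count_cons_self]; omega
        rw [e]
        exact h

theorem isPicture_pathWord (b : List Bool) : IsPicture 1 (pathWord 0 b) (b.length + 1) := by
  obtain ⟨s, hs, h⟩ := isPicture_pathWord_aux 0 0 b
  have e : 0 + b.count true + 1 + s = b.length + 1 := by omega
  rwa [e] at h

theorem isPicture_caretWord (b : List Bool) : IsPicture 1 (caretWord b) (b.length + 2) := by
  obtain ⟨s, hs, -⟩ := isPicture_pathWord_aux 0 0 b
  have h : IsPicture (b.count true + Kind.split.ins + s) [⟨.split, b.count true⟩]
      (b.count true + Kind.split.outs + s) := .cons .split _ s (.nil _)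
  have e1 : b.count true + Kind.split.ins + s = b.length + 1 := by simp only [Kind.ins]; omega
  have e2 : b.count true + Kind.split.outs + s = b.length + 2 := by simp only [Kind.outs]; omega
  rw [e1, e2] at h
  exact (isPicture_pathWord b).append h

/-- The edge which crosses the hyperplane of the transistor `b`: it joins the picture consisting
of the transistors strictly above `b` to the picture consisting of these and of `b`, which is the
minimal vertex of that hyperplane. -/
def caretEdge (b : List Bool) : Sym2 Vertex :=
  s(vertex (isPicture_pathWord b), vertex (isPicture_caretWord b))

/-- The half-spaces of the hyperplanes that correspond to the transistors of the infinite tree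
with the set `S` of carets. -/
def treeHalfSpaces (S : Set (List Bool)) : Set (Set Vertex) := (fun b => posHalf (caretEdge b)) '' S

/-- The infinite tree all of whose carets other than the root hang to the left. -/
def leftComb : Set (List Bool) := {b | ∃ k : ℕ, b = List.replicate k false}

/-- The infinite tree all of whose carets other than the root hang to the right. -/
def rightComb : Set (List Bool) := {b | ∃ k : ℕ, b = List.replicate k true}

end ThompsonProfile

namespace ThompsonProfile

open Stream'

/-! ### The action of pictures on streams -/

/-! A picture matches the infinite binary strings on its top wire with those on its bottom wires,
and this matching is unchanged by isomorphism and dipoles. Every edge of the complex attaches a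
caret to some wire, and the strings of the top wire that end up on that wire form a content `φ`.
Call `φ` standard at a vertex if the vertex places `φ x` on one fixed wire, as `x` behind one fixed
prefix. A transistor changes standardness only if it is a caret dividing, or a merging transistor
completing, the wire whose content is exactly `φ`. This property passes to opposite sides of
squares, so it gives an invariant of hyperplanes (`separates_of_mem_hyperplane`).

For the hyperplane of a caret `b`, the content is the cone below `b`, and the positive half-space
consists of the vertices that do not keep this cone in one piece (`mem_posHalf_caretEdge`). Hence
inclusion of these half-spaces is the prefix order reversed, and infinite trees give profiles.

For any other hyperplane the opposite happens. With all carets of a picture put above all merging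
transistors (`exists_splits_merges`), the hyperplane can be crossed only while merging, so `φ` is
standard at every vertex beyond it (`stdAt_of_mem_posHalf`). Such a half-space cannot occur in a
fixed profile. An element of `F` that changes `φ` on a small cone only would put into the profile a
second half-space, of a content agreeing with `φ` elsewhere; at a common vertex both contents are
standard, so they coincide. The sole escape is that the changed content is a prefix map; two
disjoint cones then show that `φ` itself is one and was not changed (`exists_caretEdge_of_fixed`).

A fixed profile is thus an `F`-invariant tree of carets. `F` relates carets that touch the same
sides of the full tree (`exists_carries`) and preserves both sides, which leaves the two combs,
their union and the full tree (`IsTree.eq_of_forall_mem`). -/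

/-- Points of a row of wires, each of which is a copy of the space of infinite binary strings. -/
abbrev Point : Type := ℕ × Stream' Bool

/-- A transistor matches the points of the row of wires above it with those of the row below: a
caret consumes the first letter of a point on its top wire. -/
def Atom.map : Atom → Point → Point
  | ⟨.split, p⟩, (j, x) =>
    if j < p then (j, x) else if j = p then (p + x.head.toNat, x.tail) else (j + 1, x)
  | ⟨.merge, p⟩, (j, x) =>
    if j < p then (j, x) else if j = p then (p, cons false x)
      else if j = p + 1 then (p, cons true x) else (j - 1, x)

theorem Atom.map_right (k : Kind) {p j : ℕ} (h : j < p) (x : Stream' Bool) :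
    Atom.map ⟨k, p⟩ (j, x) = (j, x) := by
  cases k <;> simp [Atom.map, h]

theorem Atom.map_left (k : Kind) (p r : ℕ) (x : Stream' Bool) :
    Atom.map ⟨k, p⟩ (p + k.ins + r, x) = (p + k.outs + r, x) := by
  cases k
  · change (if p + 1 + r < p then _ else if p + 1 + r = p then _ else _) = (p + 2 + r, x)
    rw [if_neg (by omega), if_neg (by omega)]
    exact Prod.ext (by simp only [Kind.ins]; omega) rfl
  · change (if p + 2 + r < p then _ else if p + 2 + r = p then _ else
      if p + 2 + r = p + 1 then _ else _) = (p + 1 + r, x)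
    rw [if_neg (by omega), if_neg (by omega), if_neg (by omega)]
    exact Prod.ext (by simp only [Kind.ins]; omega) rfl

theorem Atom.map_split (p : ℕ) (d : Bool) (x : Stream' Bool) :
    Atom.map ⟨.split, p⟩ (p, cons d x) = (p + d.toNat, x) := by
  simp [Atom.map, Stream'.tail_cons]

theorem Atom.map_merge (p : ℕ) (d : Bool) (x : Stream' Bool) :
    Atom.map ⟨.merge, p⟩ (p + d.toNat, x) = (p, cons d x) := by
  cases d <;> simp [Atom.map]

theorem exists_eq_cons (x : Stream' Bool) : ∃ d y, x = cons d y :=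
  ⟨x.head, x.tail, (Stream'.eta x).symm⟩

/-- The four possible positions of a wire with respect to a transistor. -/
theorem wire_cases (k : Kind) (p j : ℕ) :
    j < p ∨ (∃ r, j = p + k.ins + r) ∨ (k = .split ∧ j = p) ∨
      (k = .merge ∧ ∃ d : Bool, j = p + d.toNat) := by
  rcases lt_or_ge j p with h | h
  · exact .inl h
  rcases lt_or_ge j (p + k.ins) with h' | h'
  · cases k
    · exact .inr (.inr (.inl ⟨rfl, by simp only [Kind.ins] at h'; omega⟩))
    · refine .inr (.inr (.inr ⟨rfl, ?_⟩))
      simp only [Kind.ins] at h'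
      rcases (by omega : j = p ∨ j = p + 1) with rfl | rfl
      exacts [⟨false, rfl⟩, ⟨true, rfl⟩]
  · exact .inr (.inl ⟨j - (p + k.ins), by omega⟩)

theorem Atom.map_flip (a : Atom) (q : Point) : a.flip.map (a.map q) = q := by
  obtain ⟨k, p⟩ := a
  obtain ⟨j, x⟩ := q
  rcases wire_cases k p j with h | ⟨r, rfl⟩ | ⟨rfl, rfl⟩ | ⟨rfl, d, rfl⟩
  · rw [Atom.map_right k h, Atom.flip, Atom.map_right _ h]
  · rw [Atom.map_left]
    simpa [Atom.flip] using Atom.map_left k.flip p r x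
  · obtain ⟨d, y, rfl⟩ := exists_eq_cons x
    rw [Atom.map_split]
    exact Atom.map_merge _ _ _
  · rw [Atom.map_merge]
    exact Atom.map_split _ _ _

/-- The composition of the actions of the transistors of a word. -/
def Word.map (w : Word) (q : Point) : Point := w.foldl (fun q a => a.map q) q

@[simp] theorem Word.map_nil (q : Point) : Word.map [] q = q := rfl

@[simp] theorem Word.map_cons (a : Atom) (w : Word) (q : Point) :
    Word.map (a :: w) q = Word.map w (a.map q) := rfl

@[simp] theorem Word.map_append (u v : Word) (q : Point) :
    Word.map (u ++ v) q = Word.map v (Word.map u q) := List.foldl_append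

theorem Word.flip_cons (a : Atom) (w : Word) : Word.flip (a :: w) = Word.flip w ++ [a.flip] := by
  simp [Word.flip]

theorem Word.map_flip (w : Word) (q : Point) : Word.map (Word.flip w) (Word.map w q) = q := by
  induction w generalizing q with
  | nil => rfl
  | cons a w ih => simp [Word.flip_cons, ih, Atom.map_flip]

theorem Word.map_flip' (w : Word) (q : Point) : Word.map w (Word.map (Word.flip w) q) = q := by
  simpa [Word.flip_flip] using Word.map_flip (Word.flip w) q

theorem Word.map_injective (w : Word) : Function.Injective (Word.map w) :=
  Function.LeftInverse.injective (Word.map_flip w)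

theorem Atom.map_interchange (k k' : Kind) (i j : ℕ) (q : Point) :
    Atom.map ⟨k', i + k.outs + j⟩ (Atom.map ⟨k, i⟩ q) =
      Atom.map ⟨k, i⟩ (Atom.map ⟨k', i + k.ins + j⟩ q) := by
  obtain ⟨l, x⟩ := q
  rcases wire_cases k i l with h | ⟨r, rfl⟩ | ⟨rfl, rfl⟩ | ⟨rfl, d, rfl⟩
  · rw [Atom.map_right k h, Atom.map_right k' (by omega), Atom.map_right k' (by omega),
      Atom.map_right k h]
  · rw [Atom.map_left]
    rcases wire_cases k' j r with h | ⟨s, rfl⟩ | ⟨rfl, rfl⟩ | ⟨rfl, d, rfl⟩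
    · rw [Atom.map_right k' (by omega), Atom.map_right k' (by omega), Atom.map_left]
    · have h1 := Atom.map_left k' (i + k.outs + j) s x
      have h2 := Atom.map_left k' (i + k.ins + j) s x
      have h3 := Atom.map_left k i (j + k'.outs + s) x
      simp only [add_assoc] at h1 h2 h3 ⊢
      rw [h1, h2, h3]
    · obtain ⟨d, y, rfl⟩ := exists_eq_cons x
      rw [Atom.map_split, Atom.map_split, add_assoc _ r, add_assoc _ r, Atom.map_left]
    · rw [← add_assoc, ← add_assoc, Atom.map_merge, Atom.map_merge, Atom.map_left]
  · obtain ⟨d, y, rfl⟩ := exists_eq_cons x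
    have hd : d.toNat ≤ 1 := Bool.toNat_le d
    simp only [Kind.ins, Kind.outs]
    rw [Atom.map_right k' (by omega : l < l + 1 + j), Atom.map_split,
      Atom.map_right k' (by omega)]
  · have hd : d.toNat ≤ 1 := Bool.toNat_le d
    simp only [Kind.ins, Kind.outs]
    rw [Atom.map_right k' (by omega : i + d.toNat < i + 2 + j), Atom.map_merge,
      Atom.map_right k' (by omega)]

theorem Step.map_eq {u v : Word} (h : Step u v) : Word.map u = Word.map v := by
  funext q
  cases h with
  | interchange u v k k' i j => simp [Atom.map_interchange]
  | dipole u v k i =>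
    have := Atom.map_flip ⟨k, i⟩
    simp only [Atom.flip] at this
    simp [this]

/-- The action of a picture modulo dipoles. -/
def Diagram.map {m n : ℕ} (D : Diagram m n) : Point → Point :=
  Quotient.lift (fun P : Picture m n => Word.map P.word) (fun P Q h => by
    induction h with
    | rel _ _ h => exact h.map_eq
    | refl _ => rfl
    | symm _ _ _ ih => exact ih.symm
    | trans _ _ _ _ _ ih₁ ih₂ => exact ih₁.trans ih₂) D

/-- The matching of the top wire of a vertex with its bottom wires. -/
def vertexMap (v : Vertex) (x : Stream' Bool) : Point := v.2.map (0, x)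

theorem vertexMap_vertex {w : Word} {n : ℕ} (h : IsPicture 1 w n) (x : Stream' Bool) :
    vertexMap (vertex h) x = Word.map w (0, x) := rfl

theorem vertexMap_injective (v : Vertex) : Function.Injective (vertexMap v) := by
  obtain ⟨n, d⟩ := v
  induction d using Quotient.ind with
  | _ P => exact (Word.map_injective P.word).comp (Prod.mk_right_injective 0)

theorem Word.map_fst_lt {m n : ℕ} {w : Word} (h : IsPicture m w n) {q : Point} (hq : q.1 < m) :
    (Word.map w q).1 < n := by
  induction h generalizing q with
  | nil => exact hq
  | @cons k l r w n _ ih =>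
    apply ih
    change (Atom.map ⟨k, l⟩ q).1 < _
    obtain ⟨j, x⟩ := q
    rcases wire_cases k l j with h | ⟨s, rfl⟩ | ⟨rfl, rfl⟩ | ⟨rfl, d, rfl⟩
    · rw [Atom.map_right k h]; dsimp only; omega
    · rw [Atom.map_left]; dsimp only at hq ⊢; omega
    · obtain ⟨d, y, rfl⟩ := exists_eq_cons x
      have hd : d.toNat ≤ 1 := Bool.toNat_le d
      rw [Atom.map_split]; simp only [Kind.outs]; omega
    · rw [Atom.map_merge]; simp only [Kind.outs]; omega

/-! ### Standard contents and the transistors that change standardness -/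

/-- A function from streams to points is standard if it appends a fixed prefix and places the
result on a fixed wire. -/
def Std (ψ : Stream' Bool → Point) : Prop := ∃ i, ∃ t : List Bool, ∀ x, ψ x = (i, t ++ₛ x)

theorem std_merge {ψ : Stream' Bool → Point} (h : Std ψ) (p : ℕ) :
    Std fun x => Atom.map ⟨.merge, p⟩ (ψ x) := by
  obtain ⟨i, t, h⟩ := h
  rcases wire_cases .merge p i with h' | ⟨r, rfl⟩ | ⟨h', -⟩ | ⟨-, d, rfl⟩
  · exact ⟨i, t, fun x => by dsimp only; rw [h, Atom.map_right _ h']⟩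
  · exact ⟨_, t, fun x => by dsimp only; rw [h, Atom.map_left]⟩
  · cases h'
  · exact ⟨p, d :: t, fun x => by dsimp only; rw [h, Atom.map_merge]; rfl⟩

/-- Only a caret on a wire can destroy standardness there. -/
theorem std_atom {ψ : Stream' Bool → Point} {i : ℕ} {t : List Bool} (h : ∀ x, ψ x = (i, t ++ₛ x))
    (a : Atom) : (Std fun x => a.map (ψ x)) ∨ (a = ⟨.split, i⟩ ∧ t = []) := by
  obtain ⟨k, p⟩ := a
  rcases wire_cases k p i with h' | ⟨r, rfl⟩ | ⟨rfl, rfl⟩ | ⟨rfl, d, rfl⟩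
  · exact .inl ⟨i, t, fun x => by dsimp only; rw [h, Atom.map_right _ h']⟩
  · exact .inl ⟨_, t, fun x => by dsimp only; rw [h, Atom.map_left]⟩
  · cases t with
    | nil => exact .inr ⟨rfl, rfl⟩
    | cons d t =>
      exact .inl ⟨i + d.toNat, t, fun x => by
        dsimp only; rw [h, Stream'.cons_append_stream, Atom.map_split]⟩
  · exact .inl ⟨p, d :: t, fun x => by dsimp only; rw [h, Atom.map_merge]; rfl⟩

/-- Strings with different first letters leave the caret on different wires. -/
theorem not_std_split {ψ : Stream' Bool → Point} {i : ℕ} (h : ∀ x, ψ x = (i, x)) :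
    ¬ Std fun x => Atom.map ⟨.split, i⟩ (ψ x) := by
  rintro ⟨j, t, ht⟩
  have h0 := ht (cons false (Stream'.const false))
  have h1 := ht (cons true (Stream'.const false))
  dsimp only at h0 h1
  rw [h, Atom.map_split] at h0 h1
  have := congrArg Prod.fst h0
  have := congrArg Prod.fst h1
  simp at *
  omega

/-- The restriction of the matching of `v` to the wire with content `φ` is standard. -/
def StdAt (φ : Stream' Bool → Stream' Bool) (v : Vertex) : Prop := Std fun x => vertexMap v (φ x)

/-- An edge that separates the vertices at which `φ` is standard from the other ones. -/
def Separates (φ : Stream' Bool → Stream' Bool) (e : Sym2 Vertex) : Prop :=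
  ∃ a b, e = s(a, b) ∧ StdAt φ a ∧ ¬ StdAt φ b

theorem separates_iff {φ : Stream' Bool → Stream' Bool} {a b : Vertex} :
    Separates φ s(a, b) ↔ ¬ (StdAt φ a ↔ StdAt φ b) := by
  constructor
  · rintro ⟨a', b', h, h1, h2⟩
    rcases Sym2.eq_iff.1 h with ⟨rfl, rfl⟩ | ⟨rfl, rfl⟩ <;> tauto
  · intro h
    by_cases ha : StdAt φ a
    · exact ⟨a, b, rfl, ha, by tauto⟩
    · exact ⟨b, a, Sym2.eq_swap, by tauto, ha⟩

/-- A transistor that changes standardness. -/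
def Changes (a : Atom) (ψ : Stream' Bool → Point) : Prop := ¬ (Std ψ ↔ Std fun x => a.map (ψ x))

/-- By `std_atom`, standardness is lost only at a caret on a wire filled exactly by `ψ`. Gaining it
is losing it in the mirror image, which gives the merging case. -/
theorem changes_iff {a : Atom} {ψ : Stream' Bool → Point} :
    Changes a ψ ↔ (a.kind = .split ∧ ∀ x, ψ x = (a.pos, x)) ∨
      (a.kind = .merge ∧ ∀ x, a.map (ψ x) = (a.pos, x)) := by
  constructor
  · intro h
    by_cases hs : Std ψ
    · obtain ⟨i, t, ht⟩ := hs
      rcases std_atom ht a with h' | ⟨rfl, rfl⟩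
      · exact absurd ⟨fun _ => h', fun _ => ⟨i, t, ht⟩⟩ h
      · exact .inl ⟨rfl, ht⟩
    · have hs' : Std fun x => a.map (ψ x) := by unfold Changes at h; tauto
      obtain ⟨i, t, ht⟩ := hs'
      rcases std_atom ht a.flip with h' | ⟨h', rfl⟩
      · simp only [Atom.map_flip] at h'
        exact absurd h' hs
      · obtain ⟨k, p⟩ := a
        simp only [Atom.flip, Atom.mk.injEq] at h'
        obtain ⟨h', rfl⟩ := h'
        cases k
        · cases h'
        · exact .inr ⟨rfl, ht⟩
  · obtain ⟨k, p⟩ := a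
    rintro (⟨h, h'⟩ | ⟨h, h'⟩) hiff <;> dsimp only at h <;> subst h
    · exact not_std_split h' (hiff.1 ⟨p, [], h'⟩)
    · refine not_std_split h' ?_
      have := hiff.2 ⟨p, [], h'⟩
      convert this using 2 with x
      exact Atom.map_flip ⟨.merge, p⟩ _

/-- A transistor elsewhere does not touch the wire on which `ψ` is divided or completed. -/
theorem Changes.interchange_left {k k' : Kind} {i j : ℕ} {ψ : Stream' Bool → Point}
    (h : Changes ⟨k, i⟩ ψ) : Changes ⟨k, i⟩ fun x => Atom.map ⟨k', i + k.ins + j⟩ (ψ x) := by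
  rw [changes_iff] at h ⊢
  rcases h with ⟨rfl, h⟩ | ⟨rfl, h⟩ <;> dsimp only at h
  · refine .inl ⟨rfl, fun x => ?_⟩
    simp only [Kind.ins]
    rw [h, Atom.map_right _ (by omega)]
  · refine .inr ⟨rfl, fun x => ?_⟩
    dsimp only
    rw [← Atom.map_interchange, h]
    simp only [Kind.outs]
    rw [Atom.map_right _ (by omega)]

theorem Changes.interchange_right {k k' : Kind} {i j : ℕ} {ψ : Stream' Bool → Point}
    (h : Changes ⟨k', i + k.ins + j⟩ ψ) :
    Changes ⟨k', i + k.outs + j⟩ fun x => Atom.map ⟨k, i⟩ (ψ x) := by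
  rw [changes_iff] at h ⊢
  rcases h with ⟨rfl, h⟩ | ⟨rfl, h⟩ <;> dsimp only at h
  · refine .inl ⟨rfl, fun x => ?_⟩
    dsimp only
    rw [h, Atom.map_left]
  · refine .inr ⟨rfl, fun x => ?_⟩
    dsimp only
    rw [Atom.map_interchange, h, Atom.map_left]

theorem separates_attach {φ : Stream' Bool → Stream' Bool} {w : Word} {a : Atom} {n n' : ℕ}
    (h : IsPicture 1 w n) (h' : IsPicture 1 (w ++ [a]) n') :
    Separates φ s(vertex h, vertex h') ↔ Changes a fun x => Word.map w (0, φ x) := by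
  rw [separates_iff, Changes]
  simp [StdAt, vertexMap_vertex]

/-! ### Words that represent the same vertex -/

theorem Diagram.mk_eq_of_step {m n : ℕ} {u v : Word} (s : Step u v) (h : IsPicture m u n)
    (h' : IsPicture m v n) : Diagram.mk ⟨u, h⟩ = Diagram.mk ⟨v, h'⟩ :=
  Quotient.sound (.rel _ _ s)

theorem IsPicture.interchange {m n : ℕ} {u v : Word} {k k' : Kind} {i j : ℕ} :
    IsPicture m (u ++ ⟨k, i⟩ :: ⟨k', i + k.outs + j⟩ :: v) n ↔
      IsPicture m (u ++ ⟨k', i + k.ins + j⟩ :: ⟨k, i⟩ :: v) n := by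
  constructor
  · intro h
    obtain ⟨p, hu, hp⟩ := h.of_append
    obtain ⟨r, rfl, hq⟩ := hp.of_cons
    obtain ⟨r', hr, h⟩ := hq.of_cons
    dsimp only at hr h hu
    refine hu.append ?_
    obtain rfl : r = j + k'.ins + r' := by omega
    have h2 : IsPicture (i + k.ins + (j + k'.outs + r')) (⟨k, i⟩ :: v) n := by
      refine .cons k i _ ?_
      convert h using 1; omega
    have h3 : IsPicture (i + k.ins + j + k'.ins + r') (⟨k', i + k.ins + j⟩ :: ⟨k, i⟩ :: v) n := by
      refine .cons k' _ r' ?_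
      convert h2 using 1; omega
    convert h3 using 1; omega
  · intro h
    obtain ⟨p, hu, hp⟩ := h.of_append
    obtain ⟨r, rfl, hq⟩ := hp.of_cons
    obtain ⟨r', hr, h⟩ := hq.of_cons
    dsimp only at hr h hu
    refine hu.append ?_
    obtain rfl : r' = j + k'.outs + r := by omega
    have h2 : IsPicture (i + k.outs + j + k'.ins + r) (⟨k', i + k.outs + j⟩ :: v) n := by
      refine .cons k' _ r ?_
      convert h using 1; omega
    have h3 : IsPicture (i + k.ins + (j + k'.ins + r)) (⟨k, i⟩ :: ⟨k', i + k.outs + j⟩ :: v) n := by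
      refine .cons k i _ ?_
      convert h2 using 1; omega
    convert h3 using 1; omega

theorem IsPicture.dipole {m n : ℕ} {u v : Word} {k : Kind} {i : ℕ}
    (h : IsPicture m (u ++ ⟨k, i⟩ :: ⟨k.flip, i⟩ :: v) n) : IsPicture m (u ++ v) n := by
  obtain ⟨p, hu, hp⟩ := h.of_append
  obtain ⟨r, rfl, hq⟩ := hp.of_cons
  obtain ⟨r', hr, h⟩ := hq.of_cons
  dsimp only at hr h hu
  refine hu.append ?_
  simp only [Kind.flip_ins, Kind.flip_outs] at hr h
  obtain rfl : r = r' := by omega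
  exact h

/-- Words of planar pictures with one top wire that represent the same vertices. -/
def SameVertex (u v : Word) : Prop :=
  ∀ ⦃n : ℕ⦄ (h : IsPicture 1 u n), ∃ h' : IsPicture 1 v n, vertex h = vertex h'

theorem SameVertex.refl (u : Word) : SameVertex u u := fun _ h => ⟨h, rfl⟩

theorem SameVertex.trans {u v w : Word} (h : SameVertex u v) (h' : SameVertex v w) :
    SameVertex u w := fun _ hu =>
  let ⟨hv, e⟩ := h hu
  let ⟨hw, e'⟩ := h' hv
  ⟨hw, e.trans e'⟩

theorem vertex_eq_iff {u v : Word} {n : ℕ} (h : IsPicture 1 u n) (h' : IsPicture 1 v n) :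
    vertex h = vertex h' ↔ Diagram.mk ⟨u, h⟩ = Diagram.mk ⟨v, h'⟩ := by
  simp [vertex]

theorem SameVertex.append {u v : Word} (h : SameVertex u v) (w : Word) :
    SameVertex (u ++ w) (v ++ w) := by
  intro n huw
  obtain ⟨p, hu, hw⟩ := huw.of_append
  obtain ⟨hv, e⟩ := h hu
  refine ⟨hv.append hw, ?_⟩
  rw [vertex_eq_iff] at e ⊢
  exact congrArg (fun D => Diagram.comp D (Diagram.mk ⟨w, hw⟩)) e

theorem sameVertex_interchange (u v : Word) (k k' : Kind) (i j : ℕ) :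
    SameVertex (u ++ ⟨k, i⟩ :: ⟨k', i + k.outs + j⟩ :: v)
      (u ++ ⟨k', i + k.ins + j⟩ :: ⟨k, i⟩ :: v) := fun _ h =>
  ⟨IsPicture.interchange.1 h,
    (vertex_eq_iff _ _).2 (Diagram.mk_eq_of_step (.interchange u v k k' i j) _ _)⟩

theorem sameVertex_interchange' (u v : Word) (k k' : Kind) (i j : ℕ) :
    SameVertex (u ++ ⟨k', i + k.ins + j⟩ :: ⟨k, i⟩ :: v)
      (u ++ ⟨k, i⟩ :: ⟨k', i + k.outs + j⟩ :: v) := fun _ h =>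
  ⟨IsPicture.interchange.2 h,
    ((vertex_eq_iff _ _).2 (Diagram.mk_eq_of_step (.interchange u v k k' i j) _ _)).symm⟩

/-- Only removal is available: a dipole inserted at an arbitrary place may lack the wires to be
attached to. -/
theorem sameVertex_dipole (u v : Word) (k : Kind) (i : ℕ) :
    SameVertex (u ++ ⟨k, i⟩ :: ⟨k.flip, i⟩ :: v) (u ++ v) := fun _ h =>
  ⟨h.dipole, (vertex_eq_iff _ _).2 (Diagram.mk_eq_of_step (.dipole u v k i) _ _)⟩

/-! ### Separation of standardness is constant along a hyperplane -/

theorem Opposite.separates_iff {φ : Stream' Bool → Stream' Bool} {e e' : Sym2 Vertex}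
    (h : Opposite e e') : Separates φ e ↔ Separates φ e' := by
  cases h with
  | @left w k k' i j n₀ n₁ n₂ n₃ h₀ h₁ h₂ h₃ =>
    obtain ⟨h₃', e⟩ := sameVertex_interchange w [] k k' i j h₃
    have h₃'' : IsPicture 1 ((w ++ [⟨k', i + k.ins + j⟩]) ++ [⟨k, i⟩]) n₃ := by simpa using h₃'
    rw [e, vertex_congr h₃' h₃'' (by simp), separates_attach, separates_attach]
    constructor
    · intro h
      simpa using h.interchange_left
    · intro h
      -- The converse is the same implication with the other transistor undone by its mirror image.
      have := h.interchange_left (k' := k'.flip) (j := j)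
      simpa [← Atom.flip.eq_1 ⟨k', i + k.ins + j⟩, Atom.map_flip] using this
  | @right w k k' i j n₀ n₁ n₂ n₃ h₀ h₁ h₂ h₃ =>
    have h₃'' : IsPicture 1 ((w ++ [⟨k, i⟩]) ++ [⟨k', i + k.outs + j⟩]) n₃ := by simpa using h₃
    rw [vertex_congr h₃ h₃'' (by simp), separates_attach, separates_attach]
    constructor
    · intro h
      simpa using h.interchange_right
    · intro h
      have := Changes.interchange_right (k := k.flip) (k' := k') (i := i) (j := j) (by simpa using h)
      simpa [← Atom.flip.eq_1 ⟨k, i⟩, Atom.map_flip] using this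

theorem separates_of_mem_hyperplane {φ : Stream' Bool → Stream' Bool} {e e' : Sym2 Vertex}
    (h : e' ∈ hyperplane e) : Separates φ e ↔ Separates φ e' := by
  induction h with
  | rel _ _ h => exact h.separates_iff
  | refl _ => rfl
  | symm _ _ _ ih => exact ih.symm
  | trans _ _ _ _ _ ih₁ ih₂ => exact ih₁.trans ih₂

/-! ### Addresses of wires -/

/-- `Carries w j c i t`: the part of wire number `j` below the address `c` passes undivided through
the picture `w`, and becomes the part of wire number `i` below the address `t`. -/
inductive Carries : Word → ℕ → List Bool → ℕ → List Bool → Prop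
  | nil (j : ℕ) (c : List Bool) : Carries [] j c j c
  | left (k : Kind) (p r : ℕ) {w : Word} {c : List Bool} {i : ℕ} {t : List Bool} :
      Carries w (p + k.outs + r) c i t → Carries (⟨k, p⟩ :: w) (p + k.ins + r) c i t
  | right (k : Kind) {p j : ℕ} (hj : j < p) {w : Word} {c : List Bool} {i : ℕ} {t : List Bool} :
      Carries w j c i t → Carries (⟨k, p⟩ :: w) j c i t
  | split (j : ℕ) (d : Bool) {w : Word} {c : List Bool} {i : ℕ} {t : List Bool} :
      Carries w (j + d.toNat) c i t → Carries (⟨.split, j⟩ :: w) j (d :: c) i t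
  | merge (j : ℕ) (d : Bool) {w : Word} {c : List Bool} {i : ℕ} {t : List Bool} :
      Carries w j (d :: c) i t → Carries (⟨.merge, j⟩ :: w) (j + d.toNat) c i t

namespace Carries

variable {u v w : Word} {i j l : ℕ} {c s t : List Bool}

/-- The converse fails in general: a caret cancelled by a later merging transistor divides the wire
without affecting the map. -/
theorem map (h : Carries w j c i t) (x : Stream' Bool) :
    Word.map w (j, c ++ₛ x) = (i, t ++ₛ x) := by
  induction h with
  | nil => rfl
  | left k p r _ ih => rw [Word.map_cons, Atom.map_left, ih]
  | right k hj _ ih => rw [Word.map_cons, Atom.map_right k hj, ih]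
  | split j d _ ih => rw [Word.map_cons, Stream'.cons_append_stream, Atom.map_split, ih]
  | merge j d _ ih => rw [Word.map_cons, Atom.map_merge, ← Stream'.cons_append_stream, ih]

theorem std (h : Carries w j c i t) : Std fun x => Word.map w (j, c ++ₛ x) := ⟨i, t, h.map⟩

theorem append (h : Carries u j c i t) (h' : Carries v i t l s) : Carries (u ++ v) j c l s := by
  induction h with
  | nil => exact h'
  | left k p r _ ih => exact left k p r (ih h')
  | right k hj _ ih => exact right k hj (ih h')
  | split j d _ ih => exact split j d (ih h')
  | merge j d _ ih => exact merge j d (ih h')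

theorem of_append (h : Carries (u ++ v) j c l s) :
    ∃ i t, Carries u j c i t ∧ Carries v i t l s := by
  induction u generalizing j c with
  | nil => exact ⟨j, c, nil j c, h⟩
  | cons a u ih =>
    cases h with
    | left k p r h =>
      obtain ⟨i, t, h1, h2⟩ := ih h
      exact ⟨i, t, left k p r h1, h2⟩
    | right k hj h =>
      obtain ⟨i, t, h1, h2⟩ := ih h
      exact ⟨i, t, right k hj h1, h2⟩
    | split j d h =>
      obtain ⟨i, t, h1, h2⟩ := ih h
      exact ⟨i, t, split j d h1, h2⟩
    | merge j d h =>
      obtain ⟨i, t, h1, h2⟩ := ih h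
      exact ⟨i, t, merge j d h1, h2⟩

theorem flip (h : Carries w j c i t) : Carries (Word.flip w) i t j c := by
  induction h with
  | nil => exact nil _ _
  | @left k p r _ c _ _ _ ih =>
    rw [Word.flip_cons]
    refine ih.append ?_
    change Carries [⟨k.flip, p⟩] _ _ _ _
    have := left k.flip p r (nil (p + k.flip.outs + r) c)
    simpa only [Kind.flip_ins, Kind.flip_outs] using this
  | right k hj _ ih =>
    rw [Word.flip_cons]
    exact ih.append (right _ hj (nil _ _))
  | split j d _ ih =>
    rw [Word.flip_cons]
    exact ih.append (merge j d (nil _ _))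
  | merge j d _ ih =>
    rw [Word.flip_cons]
    exact ih.append (split j d (nil _ _))

theorem extend (h : Carries w j c i t) (s : List Bool) : Carries w j (c ++ s) i (t ++ s) := by
  induction h with
  | nil => exact nil _ _
  | left k p r _ ih => exact left k p r ih
  | right k hj _ ih => exact right k hj ih
  | split j d _ ih => exact split j d ih
  | merge j d _ ih => exact merge j d ih

end Carries

theorem carries_atom (a : Atom) (i : ℕ) (t : List Bool) :
    (∃ j s, Carries [a] i t j s) ∨ (a = ⟨.split, i⟩ ∧ t = []) := by
  obtain ⟨k, p⟩ := a
  rcases wire_cases k p i with h | ⟨r, rfl⟩ | ⟨rfl, rfl⟩ | ⟨rfl, d, rfl⟩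
  · exact .inl ⟨_, _, .right k h (.nil _ _)⟩
  · exact .inl ⟨_, _, .left k p r (.nil _ _)⟩
  · cases t with
    | nil => exact .inr ⟨rfl, rfl⟩
    | cons d t => exact .inl ⟨_, _, .split i d (.nil _ _)⟩
  · exact .inl ⟨_, _, .merge p d (.nil _ _)⟩

/-- Each transistor consumes at most one letter of the address. -/
theorem exists_carries_of_length_le {w : Word} (j : ℕ) {c : List Bool} (h : w.length ≤ c.length) :
    ∃ i t, Carries w j c i t := by
  induction w generalizing j c with
  | nil => exact ⟨j, c, .nil _ _⟩
  | cons a w ih =>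
    simp only [List.length_cons] at h
    obtain ⟨k, p⟩ := a
    rcases wire_cases k p j with h' | ⟨r, rfl⟩ | ⟨rfl, rfl⟩ | ⟨rfl, d, rfl⟩
    · obtain ⟨i, t, hc⟩ := ih j (c := c) (by omega)
      exact ⟨i, t, .right k h' hc⟩
    · obtain ⟨i, t, hc⟩ := ih (p + k.outs + r) (c := c) (by omega)
      exact ⟨i, t, .left k p r hc⟩
    · cases c with
      | nil => simp at h
      | cons d c =>
        simp only [List.length_cons] at h
        obtain ⟨i, t, hc⟩ := ih (j + d.toNat) (c := c) (by omega)
        exact ⟨i, t, .split j d hc⟩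
    · obtain ⟨i, t, hc⟩ := ih p (c := d :: c) (by simp only [List.length_cons]; omega)
      exact ⟨i, t, .merge p d hc⟩

theorem add_count_true_cons (p : ℕ) (d : Bool) (b : List Bool) :
    p + (d :: b).count true = p + d.toNat + b.count true := by
  cases d <;> simp
  omega

theorem carries_pathWord (p : ℕ) (b t : List Bool) :
    Carries (pathWord p b) p (b ++ t) (p + b.count true) t := by
  induction b generalizing p with
  | nil => exact .nil _ _
  | cons d b ih =>
    rw [add_count_true_cons]
    exact .split p d (ih (p + d.toNat))

theorem carries_pathWord_of_lt {p j : ℕ} (h : p < j) (b c : List Bool) :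
    Carries (pathWord p b) j c (j + b.length) c := by
  induction b generalizing p j with
  | nil => exact .nil _ _
  | cons d b ih =>
    have hd : d.toNat ≤ 1 := Bool.toNat_le d
    obtain ⟨r, rfl⟩ : ∃ r, j = p + Kind.split.ins + r :=
      ⟨j - (p + 1), by simp only [Kind.ins]; omega⟩
    refine .left .split p r ?_
    have := ih (p := p + d.toNat) (j := p + Kind.split.outs + r) (by simp only [Kind.outs]; omega)
    convert this using 1
    simp only [Kind.ins, Kind.outs, List.length_cons]; omega

theorem carries_pathWord_of_gt {p j : ℕ} (h : j < p) (b c : List Bool) :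
    Carries (pathWord p b) j c j c := by
  induction b generalizing p with
  | nil => exact .nil _ _
  | cons d b ih => exact .right .split h (ih (by omega))

/-- The caret `b` leaves undivided every address `c` which is not a prefix of `b`. -/
theorem carries_caret_of_not_prefix {b c : List Bool} (h : ¬ c <+: b) (p : ℕ) :
    ∃ i t, Carries (pathWord p b ++ [⟨.split, p + b.count true⟩]) p c i t := by
  induction b generalizing p c with
  | nil =>
    cases c with
    | nil => exact absurd List.prefix_rfl h
    | cons d c => exact ⟨_, _, .split p d (.nil _ _)⟩
  | cons e b ih =>
    rw [add_count_true_cons]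
    cases c with
    | nil => exact absurd List.nil_prefix h
    | cons d c =>
      by_cases hde : d = e
      · subst hde
        obtain ⟨i, t, hc⟩ := ih (c := c) (fun h' => h (by simpa using h')) (p + d.toNat)
        exact ⟨i, t, .split p d hc⟩
      -- Once `c` leaves the path, it lies on a wire to the right of it (`e = false`) or to the
      -- left, where the path attaches no more carets.
      · have hb : b.count true ≤ b.length := List.count_le_length
        cases e
        · obtain rfl : d = true := by simpa using hde
          obtain ⟨r, hr⟩ : ∃ r, p + true.toNat + b.length = p + b.count true + Kind.split.ins + r :=
            ⟨b.length - b.count true, by simp only [Kind.ins, Bool.toNat_true]; omega⟩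
          have h1 := carries_pathWord_of_lt (p := p) (j := p + true.toNat) (by simp) b c
          rw [hr] at h1
          exact ⟨_, _, .split p true (h1.append (.left .split (p + b.count true) r (.nil _ _)))⟩
        · obtain rfl : d = false := by simpa using hde
          exact ⟨_, _, .split p false
            ((carries_pathWord_of_gt (by simp) b c).append (.right .split (by simp; omega)
              (.nil _ _)))⟩

/-! ### The hyperplanes of carets -/

/-- A transistor to the left of a path slides below it and keeps its number, while the path is
renumbered. -/
theorem sameVertex_pathWord_left (u : Word) (k : Kind) (p r : ℕ) (t : List Bool) :
    SameVertex (u ++ ⟨k, p⟩ :: pathWord (p + k.outs + r) t)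
      (u ++ pathWord (p + k.ins + r) t ++ [⟨k, p⟩]) := by
  induction t generalizing u r with
  | nil => simpa [pathWord] using SameVertex.refl (u ++ [⟨k, p⟩])
  | cons d t ih =>
    have h1 := sameVertex_interchange u (pathWord (p + k.outs + r + d.toNat) t) k .split p r
    have h2 := ih (u ++ [⟨.split, p + k.ins + r⟩]) (r + d.toNat)
    simp only [List.append_assoc, List.singleton_append, ← add_assoc] at h2
    simpa [pathWord] using h1.trans h2

/-- Sliding below a path on its left, the transistor is pushed one wire to the right by each caret
of the path. -/
theorem sameVertex_pathWord_right (u : Word) (k : Kind) {p i : ℕ} (h : i < p) (t : List Bool) :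
    SameVertex (u ++ ⟨k, p⟩ :: pathWord i t) (u ++ pathWord i t ++ [⟨k, p + t.length⟩]) := by
  induction t generalizing u p i with
  | nil => simpa [pathWord] using SameVertex.refl (u ++ [⟨k, p⟩])
  | cons d t ih =>
    obtain ⟨j, rfl⟩ : ∃ j, p = i + Kind.split.ins + j :=
      ⟨p - (i + 1), by simp only [Kind.ins]; omega⟩
    have hd : d.toNat ≤ 1 := Bool.toNat_le d
    have h1 := sameVertex_interchange' u (pathWord (i + d.toNat) t) .split k i j
    have h2 := ih (u ++ [⟨.split, i⟩]) (p := i + Kind.split.outs + j) (i := i + d.toNat)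
      (by simp only [Kind.outs]; omega)
    have e : i + Kind.split.outs + j + t.length =
        i + Kind.split.ins + j + (t.length + 1) := by
      simp only [Kind.ins, Kind.outs]; omega
    rw [e] at h2
    simp only [List.append_assoc, List.singleton_append] at h2
    simpa [pathWord] using h1.trans h2

/-- The caret attached to the bottom wire number `i` of the picture `w` crosses the hyperplane of
the caret `c`. -/
def CrossesCaret (c : List Bool) (w : Word) (i : ℕ) : Prop :=
  ∀ ⦃n n' : ℕ⦄ (h : IsPicture 1 w n) (h' : IsPicture 1 (w ++ [⟨.split, i⟩]) n'),
    s(vertex h, vertex h') ∈ hyperplane (caretEdge c)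

theorem CrossesCaret.of_sameVertex {c : List Bool} {u v : Word} {i : ℕ}
    (h : CrossesCaret c u i) (e : SameVertex v u) : CrossesCaret c v i := by
  intro n n' hv hv'
  obtain ⟨hu, e1⟩ := e hv
  obtain ⟨hu', e2⟩ := e.append _ hv'
  rw [e1, e2]
  exact h hu hu'

theorem IsPicture.of_append_singleton_ins {m n n' : ℕ} {w : Word} {k : Kind} {p : ℕ}
    (h : IsPicture m w n) (h' : IsPicture m (w ++ [⟨k, p⟩]) n') :
    ∃ r, n = p + k.ins + r ∧ n' = p + k.outs + r := by
  obtain ⟨q, hq, hs⟩ := h'.of_append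
  obtain rfl := h.width_unique hq
  obtain ⟨r, hr, hs⟩ := hs.of_cons
  exact ⟨r, hr, hs.of_nil.symm⟩

theorem IsPicture.append_singleton {m : ℕ} {w : Word} {k : Kind} {p r : ℕ}
    (h : IsPicture m w (p + k.ins + r)) : IsPicture m (w ++ [⟨k, p⟩]) (p + k.outs + r) :=
  h.append (.cons k p r (.nil _))

/-- The two edges are opposite sides of the square spanned by the caret and the other transistor. -/
theorem CrossesCaret.attach_left {c : List Bool} {w : Word} {k : Kind} {p r : ℕ}
    (h : CrossesCaret c w (p + k.ins + r)) :
    CrossesCaret c (w ++ [⟨k, p⟩]) (p + k.outs + r) := by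
  intro n n' h1 h2
  obtain ⟨n₀, h₀, -⟩ := h1.of_append
  have h3 : IsPicture 1 (w ++ [⟨k, p⟩, ⟨.split, p + k.outs + r⟩]) n' := by simpa using h2
  obtain ⟨s, e1, e2⟩ := h₀.of_append_singleton_ins h1
  obtain ⟨s', e3, e4⟩ := h1.of_append_singleton_ins h2
  have e5 : n₀ = p + k.ins + r + Kind.split.ins + s' := by omega
  subst e5
  have h4 := h₀.append_singleton
  refine .trans _ _ _ (h h₀ h4) (.rel _ _ ?_)
  rw [vertex_congr h2 h3 (by simp)]
  exact .right h₀ h1 h4 h3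

theorem CrossesCaret.attach_right {c : List Bool} {w : Word} {k : Kind} {p i : ℕ} (hi : i < p)
    (h : CrossesCaret c w i) : CrossesCaret c (w ++ [⟨k, p⟩]) i := by
  obtain ⟨j, rfl⟩ : ∃ j, p = i + Kind.split.ins + j :=
    ⟨p - (i + 1), by simp only [Kind.ins]; omega⟩
  intro n n' h1 h2
  obtain ⟨n₀, h₀, -⟩ := h1.of_append
  have h2' : IsPicture 1 (w ++ [⟨k, i + Kind.split.ins + j⟩, ⟨.split, i⟩]) n' := by simpa using h2
  obtain ⟨h3, e⟩ := sameVertex_interchange' w [] .split k i j h2'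
  obtain ⟨s, e1, -⟩ := h₀.of_append_singleton_ins h1
  have e5 : n₀ = i + Kind.split.ins + (j + k.ins + s) := by omega
  subst e5
  have h4 := h₀.append_singleton
  refine .trans _ _ _ (h h₀ h4) (.rel _ _ ?_)
  rw [vertex_congr h2 h2' (by simp), e]
  exact .left h₀ h4 h1 h3

/-- Allowing a remaining address `t`, whose path is attached below, lets the last transistor of `w`
be removed. Off the wire, it slides below the path and spans a square with the final caret; a caret
on the wire becomes the first caret of the path; a merging transistor cancels that first caret. -/
theorem crossesCaret_of_carries_aux {w : Word} {c t : List Bool} {i : ℕ} (h : Carries w 0 c i t) :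
    CrossesCaret c (w ++ pathWord i t) (i + t.count true) := by
  induction w using List.reverseRecOn generalizing i t with
  | nil =>
    cases h
    intro n n' h h'
    simp only [List.nil_append, zero_add] at h h'
    have e1 := h.width_unique (isPicture_pathWord c)
    have e2 := h'.width_unique (isPicture_caretWord c)
    subst e1 e2
    simp only [List.nil_append, zero_add]
    exact .refl _
  | append_singleton w a ih =>
    obtain ⟨i₀, t₀, h1, h2⟩ := h.of_append
    have key := ih h1
    rw [List.append_assoc, List.singleton_append]
    cases h2 with
    | left k p r h2 =>
      cases h2
      refine CrossesCaret.of_sameVertex ?_ (sameVertex_pathWord_left w k p r t)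
      rw [add_assoc (p + k.ins)] at key
      rw [add_assoc (p + k.outs)]
      exact key.attach_left
    | right k hj h2 =>
      cases h2
      refine CrossesCaret.of_sameVertex ?_ (sameVertex_pathWord_right w k hj t)
      have : t.count true ≤ t.length := List.count_le_length
      exact key.attach_right (by omega)
    | split j d h2 =>
      cases h2
      rw [add_count_true_cons] at key
      exact key
    | merge j d h2 =>
      cases h2
      rw [add_count_true_cons]
      exact key.of_sameVertex (sameVertex_dipole w _ .merge i)

theorem crossesCaret_of_carries {w : Word} {c : List Bool} {i : ℕ} (h : Carries w 0 c i []) :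
    CrossesCaret c w i := by
  simpa [pathWord] using crossesCaret_of_carries_aux h

/-! ### The half-spaces of carets -/

/-- Attaching the mirror image creates a dipole. Every edge at a vertex can therefore be read as an
attachment to any given word for that vertex. -/
theorem Attach.symm {v v' : Vertex} (h : Attach v v') : Attach v' v := by
  cases h with
  | @mk w a n n' h h' =>
    obtain ⟨k, p⟩ := a
    obtain ⟨r, rfl, rfl⟩ := h.of_append_singleton_ins h'
    have h1 : IsPicture 1 (w ++ [⟨k, p⟩]) (p + k.flip.ins + r) := by simpa using h'
    have h2 := h1.append_singleton
    have h3 : IsPicture 1 (w ++ [⟨k, p⟩, ⟨k.flip, p⟩]) (p + k.flip.outs + r) := by simpa using h2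
    obtain ⟨h4, e⟩ := sameVertex_dipole w [] k p h3
    have key := Attach.mk h' h2
    rw [vertex_congr h2 h3 (by simp), e, vertex_congr h4 (by simpa using h4) (by simp)] at key
    convert key using 2
    simp

theorem adj_iff_attach {v v' : Vertex} : skeleton.Adj v v' ↔ Attach v v' :=
  ⟨fun h => h.elim id Attach.symm, Or.inl⟩

theorem Attach.exists_append {v v' : Vertex} (h : Attach v v') {w : Word} {n : ℕ}
    (hw : IsPicture 1 w n) (e : v = vertex hw) :
    ∃ (a : Atom) (n' : ℕ) (h' : IsPicture 1 (w ++ [a]) n'), v' = vertex h' := by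
  cases h with
  | @mk u a m m' h h' =>
    obtain ⟨p, hp, ha⟩ := h'.of_append
    obtain rfl := h.width_unique hp
    obtain rfl : m = n := congrArg Sigma.fst e
    refine ⟨a, m', hw.append ha, ?_⟩
    rw [vertex_eq_iff] at e ⊢
    exact congrArg (fun D => Diagram.comp D (Diagram.mk ⟨[a], ha⟩)) e

/-- Every edge can be read as the attachment of a caret. -/
theorem exists_split_of_adj {v v' : Vertex} (hadj : skeleton.Adj v v') :
    ∃ (w : Word) (i n n' : ℕ) (h : IsPicture 1 w n) (h' : IsPicture 1 (w ++ [⟨.split, i⟩]) n'),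
      s(v, v') = s(vertex h, vertex h') := by
  cases adj_iff_attach.1 hadj with
  | @mk w a n n' h h' =>
    obtain ⟨k, p⟩ := a
    cases k with
    | split => exact ⟨w, p, n, n', h, h', rfl⟩
    | merge =>
      obtain ⟨r, rfl, rfl⟩ := h.of_append_singleton_ins h'
      have h2 := IsPicture.append_singleton (k := .split) h'
      have h3 : IsPicture 1 (w ++ [⟨.merge, p⟩, ⟨.split, p⟩]) (p + Kind.split.outs + r) := by
        simpa using h2
      obtain ⟨h4, e⟩ := sameVertex_dipole w [] .merge p h3
      refine ⟨_, p, _, _, h', h2, ?_⟩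
      have e' : vertex h2 = vertex h :=
        (vertex_congr h2 h3 (by simp)).trans (e.trans (vertex_congr h4 h (by simp)))
      rw [e', Sym2.eq_swap]

theorem adj_vertex {w : Word} {a : Atom} {n n' : ℕ} (h : IsPicture 1 w n)
    (h' : IsPicture 1 (w ++ [a]) n') : skeleton.Adj (vertex h) (vertex h') := .inl (.mk h h')

/-- The prefixes of `w` spell an edge-path from the base vertex. -/
theorem reachable_of_forall_prefix {K : Set (Sym2 Vertex)} {w : Word} {n : ℕ}
    (h : IsPicture 1 w n)
    (H : ∀ ⦃u : Word⦄ ⦃a : Atom⦄ ⦃v : Word⦄, w = u ++ a :: v → ∀ ⦃n n' : ℕ⦄ (h : IsPicture 1 u n)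
      (h' : IsPicture 1 (u ++ [a]) n'), s(vertex h, vertex h') ∉ K) :
    (skeleton.deleteEdges K).Reachable base (vertex h) := by
  induction w using List.reverseRecOn generalizing n with
  | nil =>
    obtain rfl := h.of_nil
    exact .refl _
  | append_singleton w a ih =>
    obtain ⟨p, hp, _⟩ := h.of_append
    refine (ih hp fun u b v e => H (v := v ++ [a]) (by simp [e])).trans
      (SimpleGraph.Adj.reachable ?_)
    rw [SimpleGraph.deleteEdges_adj]
    exact ⟨adj_vertex hp h, H (v := []) rfl hp h⟩

theorem hyperplane_eq_of_mem {e e' : Sym2 Vertex} (h : e' ∈ hyperplane e) :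
    hyperplane e' = hyperplane e := by
  ext f
  exact ⟨fun h' => .trans _ _ _ h h', fun h' => .trans _ _ _ (.symm _ _ h) h'⟩

theorem posHalf_eq_of_mem {e e' : Sym2 Vertex} (h : e' ∈ hyperplane e) :
    posHalf e' = posHalf e := by
  simp only [posHalf, hyperplane_eq_of_mem h]

/-- The vertex `v` is represented by some picture through which the part of the top wire below the
address `b` passes undivided. -/
def Intact (b : List Bool) (v : Vertex) : Prop :=
  ∃ (w : Word) (n : ℕ) (h : IsPicture 1 w n), v = vertex h ∧ ∃ i t, Carries w 0 b i t

theorem Intact.stdAt {b : List Bool} {v : Vertex} (h : Intact b v) : StdAt (b ++ₛ ·) v := by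
  obtain ⟨w, n, h, rfl, i, t, hc⟩ := h
  exact hc.std

theorem Intact.extend {b : List Bool} {v : Vertex} (h : Intact b v) (s : List Bool) :
    Intact (b ++ s) v := by
  obtain ⟨w, n, h, rfl, i, t, hc⟩ := h
  exact ⟨w, n, h, rfl, i, _, hc.extend s⟩

theorem stdAt_vertex {φ : Stream' Bool → Stream' Bool} {w : Word} {n : ℕ} (h : IsPicture 1 w n) :
    StdAt φ (vertex h) ↔ Std fun x => Word.map w (0, φ x) := Iff.rfl

theorem separates_split {φ : Stream' Bool → Stream' Bool} {w : Word} {i n n' : ℕ}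
    (h : IsPicture 1 w n) (h' : IsPicture 1 (w ++ [⟨.split, i⟩]) n')
    (hφ : ∀ x, Word.map w (0, φ x) = (i, x)) : Separates φ s(vertex h, vertex h') := by
  rw [separates_attach, changes_iff]
  exact .inl ⟨rfl, hφ⟩

theorem carries_pathWord_nil (b : List Bool) : Carries (pathWord 0 b) 0 b (b.count true) [] := by
  simpa using carries_pathWord 0 b []

theorem separates_caretEdge (b : List Bool) : Separates (b ++ₛ ·) (caretEdge b) :=
  separates_split _ (isPicture_caretWord b) (carries_pathWord_nil b).map

/-- Along an edge-path the address stays undivided until a caret is put on the very wire it has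
become, and that edge crosses the hyperplane of `b`. -/
theorem intact_of_reachable {b : List Bool} {v : Vertex}
    (h : (skeleton.deleteEdges (hyperplane (caretEdge b))).Reachable base v) : Intact b v := by
  rw [SimpleGraph.reachable_iff_reflTransGen] at h
  induction h with
  | refl => exact ⟨[], 1, .nil 1, rfl, 0, b, .nil _ _⟩
  | tail _ h ih =>
    obtain ⟨w, n, hw, rfl, i, t, hc⟩ := ih
    rw [SimpleGraph.deleteEdges_adj, adj_iff_attach] at h
    obtain ⟨a, n', h', rfl⟩ := h.1.exists_append hw rfl
    rcases carries_atom a i t with ⟨j, s, ha⟩ | ⟨rfl, rfl⟩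
    · exact ⟨_, _, h', rfl, j, s, hc.append ha⟩
    · exact absurd (crossesCaret_of_carries hc hw h') h.2

/-- A word that carries `b` has only prefixes that carry `b`. Standardness of the cone below `b`
never changes along them, so their edge-path avoids the hyperplane. -/
theorem mem_posHalf_caretEdge {b : List Bool} {v : Vertex} :
    v ∈ posHalf (caretEdge b) ↔ ¬ Intact b v := by
  refine ⟨fun hv hi => hv ?_, fun hv hr => hv (intact_of_reachable hr)⟩
  obtain ⟨w, n, h, rfl, i, t, hc⟩ := hi
  refine reachable_of_forall_prefix h ?_
  rintro u a v rfl m m' h1 h2 hmem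
  have hs := (separates_of_mem_hyperplane hmem).1 (separates_caretEdge b)
  rw [List.append_cons] at hc
  obtain ⟨_, _, hc2, -⟩ := hc.of_append
  obtain ⟨_, _, hc1, -⟩ := hc2.of_append
  rw [separates_iff] at hs
  exact hs ⟨fun _ => hc2.std, fun _ => hc1.std⟩

theorem posHalf_caretEdge_mono {b c : List Bool} (h : b <+: c) :
    posHalf (caretEdge c) ⊆ posHalf (caretEdge b) := by
  obtain ⟨s, rfl⟩ := h
  intro v hv
  rw [mem_posHalf_caretEdge] at hv ⊢
  exact fun h => hv (h.extend s)

theorem vertex_caretWord_mem (b : List Bool) :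
    vertex (isPicture_caretWord b) ∈ posHalf (caretEdge b) := by
  rw [mem_posHalf_caretEdge]
  intro h
  have hs := h.stdAt
  have := separates_caretEdge b
  rw [caretEdge, separates_iff] at this
  exact this ⟨fun _ => hs, fun _ => (carries_pathWord_nil b).std⟩

/-- This one vertex decides all inclusions between half-spaces of carets. -/
theorem vertex_caretWord_mem_iff {b c : List Bool} :
    vertex (isPicture_caretWord b) ∈ posHalf (caretEdge c) ↔ c <+: b := by
  refine ⟨fun h => ?_, fun h => posHalf_caretEdge_mono h (vertex_caretWord_mem b)⟩
  rw [mem_posHalf_caretEdge] at h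
  by_contra hcon
  obtain ⟨i, t, hc⟩ := carries_caret_of_not_prefix hcon 0
  rw [zero_add] at hc
  exact h ⟨_, _, _, rfl, i, t, hc⟩

theorem posHalf_caretEdge_subset_iff {b c : List Bool} :
    posHalf (caretEdge b) ⊆ posHalf (caretEdge c) ↔ c <+: b :=
  ⟨fun h => vertex_caretWord_mem_iff.1 (h (vertex_caretWord_mem b)), posHalf_caretEdge_mono⟩

theorem posHalf_caretEdge_injective : Function.Injective fun b => posHalf (caretEdge b) := by
  intro b c h
  have h1 := posHalf_caretEdge_subset_iff.1 (subset_of_eq h)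
  have h2 := posHalf_caretEdge_subset_iff.1 (subset_of_eq h.symm)
  exact h2.eq_of_length (le_antisymm h2.length_le h1.length_le)

theorem caretEdge_mem_edgeSet (b : List Bool) : caretEdge b ∈ skeleton.edgeSet :=
  adj_vertex _ _

theorem isPosHalfSpace_caretEdge (b : List Bool) : IsPosHalfSpace (posHalf (caretEdge b)) :=
  ⟨_, caretEdge_mem_edgeSet b, rfl⟩

/-! ### Pictures without merging transistors -/

/-- A word all of whose transistors are of the kind `k`. -/
def OfKind (k : Kind) (w : Word) : Prop := ∀ a ∈ w, a.kind = k

theorem OfKind.append {k : Kind} {u v : Word} (hu : OfKind k u) (hv : OfKind k v) :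
    OfKind k (u ++ v) := fun a ha => (List.mem_append.1 ha).elim (hu a) (hv a)

theorem ofKind_append_iff {k : Kind} {u v : Word} :
    OfKind k (u ++ v) ↔ OfKind k u ∧ OfKind k v := by
  simp only [OfKind, List.mem_append, or_imp, forall_and]

theorem ofKind_singleton {k : Kind} {p : ℕ} : OfKind k [⟨k, p⟩] := by
  simp [OfKind]

theorem ofKind_pathWord (p : ℕ) (b : List Bool) : OfKind .split (pathWord p b) := by
  induction b generalizing p with
  | nil => simp [OfKind, pathWord]
  | cons d b ih =>
    have := ih (p + d.toNat)
    simpa [OfKind, pathWord] using this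

theorem OfKind.flip {k : Kind} {w : Word} (h : OfKind k w) : OfKind k.flip (Word.flip w) := by
  intro a ha
  simp only [Word.flip, List.mem_reverse, List.mem_map] at ha
  obtain ⟨b, hb, rfl⟩ := ha
  rw [Atom.flip, h b hb]

/-- Merging transistors only move wires or lengthen the fixed prefix. -/
theorem OfKind.std_of_std {w : Word} (hw : OfKind .merge w) {ψ : Stream' Bool → Point}
    (h : Std ψ) : Std fun x => Word.map w (ψ x) := by
  induction w generalizing ψ with
  | nil => exact h
  | cons a w ih =>
    obtain ⟨k, p⟩ := a
    obtain rfl : k = .merge := hw _ (List.mem_cons_self)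
    exact ih (fun b hb => hw b (List.mem_cons_of_mem _ hb)) (std_merge h p)

theorem OfKind.std_of_std_map {w : Word} (hw : OfKind .split w) {ψ : Stream' Bool → Point}
    (h : Std fun x => Word.map w (ψ x)) : Std ψ := by
  have := hw.flip.std_of_std h
  simpa only [Word.map_flip] using this

theorem OfKind.exists_carries {w : Word} (hw : OfKind .merge w) (j : ℕ) (c : List Bool) :
    ∃ i t, Carries w j c i t := by
  induction w using List.reverseRecOn with
  | nil => exact ⟨j, c, .nil _ _⟩
  | append_singleton w a ih =>
    obtain ⟨hw, ha⟩ := ofKind_append_iff.1 hw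
    obtain ⟨i, t, h⟩ := ih hw
    rcases carries_atom a i t with ⟨i', t', h'⟩ | ⟨rfl, rfl⟩
    · exact ⟨i', t', h.append h'⟩
    · cases ha _ (List.mem_singleton_self _)

/-- Without merging transistors no division is ever repaired, so `Carries.map` has a converse. -/
theorem OfKind.exists_carries_of_std {w : Word} (hw : OfKind .split w) {j : ℕ} {c : List Bool}
    (h : Std fun x => Word.map w (j, c ++ₛ x)) : ∃ i t, Carries w j c i t := by
  induction w using List.reverseRecOn with
  | nil => exact ⟨j, c, .nil _ _⟩
  | append_singleton w a ih =>
    obtain ⟨hw, ha⟩ := ofKind_append_iff.1 hw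
    simp only [Word.map_append] at h
    obtain ⟨i, t, h'⟩ := ih hw (ha.std_of_std_map h)
    rcases carries_atom a i t with ⟨i', t', h''⟩ | ⟨rfl, rfl⟩
    · exact ⟨i', t', h'.append h''⟩
    · exact absurd h (not_std_split h'.map)

theorem Carries.lt {m n : ℕ} {w : Word} {j i : ℕ} {c t : List Bool} (h : Carries w j c i t)
    (hw : IsPicture m w n) (hj : j < m) : i < n := by
  have := Word.map_fst_lt hw (q := (j, c ++ₛ Stream'.const true)) hj
  rwa [h.map] at this

/-- A bottom wire of a picture without merging transistors has an address. -/
theorem OfKind.exists_carries_nil {w : Word} (hw : OfKind .split w) {n i : ℕ}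
    (h : IsPicture 1 w n) (hi : i < n) : ∃ c, Carries w 0 c i [] := by
  obtain ⟨j, c, hc⟩ := hw.flip.exists_carries i []
  obtain rfl : j = 0 := by have := hc.lt h.flip hi; omega
  exact ⟨c, by simpa [Word.flip_flip] using hc.flip⟩

/-- The half-spaces that contain the half-space of a caret are those of the carets above it. -/
theorem exists_prefix_of_posHalf_subset {b : List Bool} {A : Set Vertex} (hA : IsPosHalfSpace A)
    (h : posHalf (caretEdge b) ⊆ A) : ∃ c, c <+: b ∧ A = posHalf (caretEdge c) := by
  obtain ⟨e, -, rfl⟩ := hA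
  have hv := h (vertex_caretWord_mem b)
  by_contra hcon
  -- The carets of `caretWord b` spell an edge-path to a vertex of `A`, so some edge of it crosses
  -- the hyperplane of `e`. Only carets lie above that edge, hence it crosses the hyperplane of a
  -- caret.
  refine hv (reachable_of_forall_prefix _ ?_)
  intro u a v huv n n' h1 h2 hmem
  have hs : OfKind .split (caretWord b) := (ofKind_pathWord 0 b).append ofKind_singleton
  rw [huv, List.append_cons, ofKind_append_iff, ofKind_append_iff] at hs
  obtain ⟨k, p⟩ := a
  obtain rfl : k = .split := hs.1.2 _ (List.mem_singleton_self _)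
  obtain ⟨r, hr, -⟩ := h1.of_append_singleton_ins h2
  obtain ⟨c, hc⟩ := hs.1.1.exists_carries_nil h1 (i := p) (by simp only [Kind.ins] at hr; omega)
  have heq : posHalf e = posHalf (caretEdge c) :=
    (posHalf_eq_of_mem hmem).symm.trans (posHalf_eq_of_mem (crossesCaret_of_carries hc h1 h2))
  exact hcon ⟨c, posHalf_caretEdge_subset_iff.1 (heq ▸ h), heq⟩

/-! ### A normal form for pictures -/

/-- A caret directly below a merging transistor either shares no wire with it and moves above it, or
sits on its bottom wire and cancels it. -/
theorem exists_splits_merges_aux {m : Word} (hm : OfKind .merge m) {s : Word}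
    (hs : OfKind .split s) (p : ℕ) :
    ∃ s' m', OfKind .split s' ∧ OfKind .merge m' ∧
      SameVertex (s ++ m ++ [⟨.split, p⟩]) (s' ++ m') := by
  induction m using List.reverseRecOn generalizing p with
  | nil =>
    refine ⟨s ++ [⟨.split, p⟩], [], hs.append ofKind_singleton, by simp [OfKind], ?_⟩
    simpa using SameVertex.refl (s ++ [⟨.split, p⟩])
  | append_singleton m a ih =>
    obtain ⟨hm₀, ha⟩ := ofKind_append_iff.1 hm
    obtain ⟨k, q⟩ := a
    obtain rfl : k = .merge := ha _ (List.mem_singleton_self _)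
    suffices h : (∃ p' q', SameVertex (s ++ m ++ [⟨.merge, q⟩, ⟨.split, p⟩])
        (s ++ m ++ [⟨.split, p'⟩, ⟨.merge, q'⟩])) ∨
        SameVertex (s ++ m ++ [⟨.merge, q⟩, ⟨.split, p⟩]) (s ++ m) by
      rcases h with ⟨p', q', h⟩ | h
      · obtain ⟨s', m', hs', hm', h'⟩ := ih hm₀ p'
        refine ⟨s', m' ++ [⟨.merge, q'⟩], hs', hm'.append ofKind_singleton, ?_⟩
        have h'' := h'.append [⟨.merge, q'⟩]
        simp only [List.append_assoc, List.singleton_append] at h h'' ⊢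
        exact h.trans h''
      · exact ⟨s, m, hs, hm₀, by simpa only [List.append_assoc, List.singleton_append] using h⟩
    rcases lt_trichotomy p q with h | rfl | h
    · obtain ⟨j, rfl⟩ : ∃ j, q = p + Kind.split.ins + j :=
        ⟨q - (p + 1), by simp only [Kind.ins]; omega⟩
      exact .inl ⟨_, _, sameVertex_interchange' (s ++ m) [] .split .merge p j⟩
    · right
      have := sameVertex_dipole (s ++ m) [] .merge p
      rw [List.append_nil] at this
      exact this
    · obtain ⟨j, rfl⟩ : ∃ j, p = q + Kind.merge.outs + j :=
        ⟨p - (q + 1), by simp only [Kind.outs]; omega⟩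
      exact .inl ⟨_, _, sameVertex_interchange (s ++ m) [] .merge .split q j⟩

/-- Modulo dipoles, all carets of a picture can be put above all of its merging transistors. -/
theorem exists_splits_merges (w : Word) :
    ∃ s m, OfKind .split s ∧ OfKind .merge m ∧ SameVertex w (s ++ m) := by
  induction w using List.reverseRecOn with
  | nil => exact ⟨[], [], by simp [OfKind], by simp [OfKind], SameVertex.refl _⟩
  | append_singleton w a ih =>
    obtain ⟨s, m, hs, hm, h⟩ := ih
    obtain ⟨k, p⟩ := a
    cases k with
    | split =>
      obtain ⟨s', m', hs', hm', h'⟩ := exists_splits_merges_aux hm hs p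
      exact ⟨s', m', hs', hm', (h.append _).trans h'⟩
    | merge =>
      refine ⟨s, m ++ [⟨.merge, p⟩], hs, hm.append ofKind_singleton, ?_⟩
      have := h.append [⟨.merge, p⟩]
      rwa [List.append_assoc s] at this

/-- One stream is not enough: prepending `false` to the constant stream `false` changes nothing. If
one prefix outlasts the other, its next letter would begin both `x` and `y`. -/
theorem append_stream_cancel {s t : List Bool} {x y : Stream' Bool} (hx : s ++ₛ x = t ++ₛ x)
    (hy : s ++ₛ y = t ++ₛ y) (hxy : x.head ≠ y.head) : s = t := by
  induction s generalizing t with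
  | nil =>
    cases t with
    | nil => rfl
    | cons d t =>
      have h1 := congrArg Stream'.head hx
      have h2 := congrArg Stream'.head hy
      simp only [Stream'.nil_append_stream, Stream'.cons_append_stream, Stream'.head_cons] at h1 h2
      exact absurd (h1.trans h2.symm) hxy
  | cons e s ih =>
    cases t with
    | nil =>
      have h1 := congrArg Stream'.head hx
      have h2 := congrArg Stream'.head hy
      simp only [Stream'.nil_append_stream, Stream'.cons_append_stream, Stream'.head_cons] at h1 h2
      exact absurd (h1.symm.trans h2) hxy
    | cons d t =>
      simp only [Stream'.cons_append_stream] at hx hy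
      obtain ⟨rfl, hx'⟩ := Stream'.cons_injective2 hx
      rw [ih hx' (Stream'.cons_injective2 hy).2]

theorem eq_of_forall_append_stream {s t : List Bool} (h : ∀ x : Stream' Bool, s ++ₛ x = t ++ₛ x) :
    s = t :=
  append_stream_cancel (h (cons true (Stream'.const true))) (h (cons false (Stream'.const true)))
    (by simp)

theorem exists_vertex (v : Vertex) : ∃ (w : Word) (n : ℕ) (h : IsPicture 1 w n), v = vertex h := by
  obtain ⟨n, d⟩ := v
  induction d using Quotient.ind with
  | _ P => exact ⟨P.word, n, P.valid, rfl⟩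

/-- At the vertices beyond a hyperplane that is not the hyperplane of a caret, the content `φ` of
the wire which the hyperplane cuts is standard. -/
theorem stdAt_of_mem_posHalf {φ : Stream' Bool → Stream' Bool} {e : Sym2 Vertex}
    (h : Separates φ e) (hbad : ∀ c : List Bool, (∀ x, φ x = c ++ₛ x) → caretEdge c ∉ hyperplane e)
    {v : Vertex} (hv : v ∈ posHalf e) : StdAt φ v := by
  obtain ⟨w, n, hw, rfl⟩ := exists_vertex v
  obtain ⟨s, m, hs, hm, hsm⟩ := exists_splits_merges w
  obtain ⟨hw', heq⟩ := hsm hw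
  rw [heq] at hv ⊢
  by_contra hstd
  refine hv (reachable_of_forall_prefix hw' ?_)
  intro u a v huv n₁ n₂ h1 h2 hmem
  have hsep := (separates_of_mem_hyperplane hmem).1 h
  rw [separates_attach, changes_iff] at hsep
  -- The crossing edge is either among the carets, with only carets above it, or among the merging
  -- transistors, with only merging transistors below it.
  have hcases : (OfKind .split u ∧ a.kind = .split) ∨ (a.kind = .merge ∧ OfKind .merge v) := by
    rcases List.append_eq_append_iff.1 huv with ⟨as, rfl, rfl⟩ | ⟨as, rfl, hm'⟩
    · have := (ofKind_append_iff.1 hm).2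
      exact .inr ⟨this a List.mem_cons_self, fun b hb => this b (List.mem_cons_of_mem _ hb)⟩
    · cases as with
      | nil =>
        rw [List.nil_append] at hm'
        rw [← hm'] at hm
        exact .inr ⟨hm a List.mem_cons_self, fun b hb => hm b (List.mem_cons_of_mem _ hb)⟩
      | cons b as =>
        obtain ⟨rfl, -⟩ := List.cons.inj hm'
        obtain ⟨h3, h4⟩ := ofKind_append_iff.1 hs
        exact .inl ⟨h3, h4 a List.mem_cons_self⟩
  rcases hcases with ⟨hu, ha⟩ | ⟨ha, hv'⟩
  · rcases hsep with ⟨-, hψ⟩ | ⟨ha', -⟩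
    -- Undoing the carets of `u` keeps `φ` standard, so `φ` prepends a fixed `c`, and the edge
    -- crosses the hyperplane of the caret `c`. This is excluded by `hbad`.
    · obtain ⟨i, c, hc⟩ := hu.std_of_std_map (ψ := fun x => (0, φ x)) ⟨a.pos, [], hψ⟩
      have hφ : ∀ x, φ x = c ++ₛ x := fun x => congrArg Prod.snd (hc x)
      obtain ⟨j, t, hct⟩ := hu.exists_carries_of_std (j := 0) (c := c)
        ⟨a.pos, [], fun x => by dsimp only; rw [← hφ]; exact hψ x⟩
      have hjt : ∀ x : Stream' Bool, (j, t ++ₛ x) = (a.pos, x) := fun x => by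
        rw [← hct.map, ← hφ, hψ]
      obtain rfl : t = [] := eq_of_forall_append_stream fun x => congrArg Prod.snd (hjt x)
      obtain rfl : j = a.pos := congrArg Prod.fst (hjt (Stream'.const true))
      obtain ⟨k, p⟩ := a
      obtain rfl : k = .split := ha
      have := crossesCaret_of_carries hct h1 h2
      exact hbad c hφ (.trans _ _ _ hmem (.symm _ _ this))
    · rw [ha] at ha'
      cases ha'
  · rcases hsep with ⟨ha', -⟩ | ⟨-, hψ⟩
    · rw [ha] at ha'
      cases ha'
    -- After the crossing, `φ` fills a wire, and further merging keeps it standard.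
    · refine hstd ?_
      rw [stdAt_vertex, huv]
      simp only [Word.map_append, Word.map_cons]
      exact hv'.std_of_std ⟨a.pos, [], hψ⟩

/-! ### Translates of half-spaces -/

theorem Diagram.map_comp {m n p : ℕ} (a : Diagram m n) (b : Diagram n p) (q : Point) :
    (a.comp b).map q = b.map (a.map q) := by
  induction a using Quotient.ind
  induction b using Quotient.ind
  exact Word.map_append _ _ _

theorem vertexMap_smul (g : F) (v : Vertex) (x : Stream' Bool) :
    vertexMap (g • v) x = v.2.map (Diagram.map g (0, x)) := Diagram.map_comp g v.2 _

theorem stdAt_smul {g : F} {φ ψ : Stream' Bool → Stream' Bool}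
    (h : ∀ x, Diagram.map g (0, ψ x) = (0, φ x)) (v : Vertex) :
    StdAt ψ (g • v) ↔ StdAt φ v := by
  simp only [StdAt, vertexMap_smul, h]
  rfl

theorem separates_smul {g : F} {φ ψ : Stream' Bool → Stream' Bool}
    (h : ∀ x, Diagram.map g (0, ψ x) = (0, φ x)) {e : Sym2 Vertex} (he : Separates φ e) :
    Separates ψ (e.map (g • ·)) := by
  obtain ⟨a, b, rfl, ha, hb⟩ := he
  exact ⟨g • a, g • b, rfl, (stdAt_smul h a).2 ha, fun hb' => hb ((stdAt_smul h b).1 hb')⟩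

theorem map_smul_mem_edgeSet (g : F) {e : Sym2 Vertex} (he : e ∈ skeleton.edgeSet) :
    e.map (g • ·) ∈ skeleton.edgeSet := by
  induction e using Sym2.ind with
  | _ a b => exact adj_smul g he

/-- By hypothesis `base` and `g⁻¹ • base` are on the same side of the hyperplane, so `g` maps the
side of `base` to the side of `base`. -/
theorem translate_posHalf (g : F) {e : Sym2 Vertex} (hb : g⁻¹ • base ∉ posHalf e) :
    translate g (posHalf e) = posHalf (e.map (g • ·)) := by
  have hb' := reachable_smul g (not_not.mp hb)
  rw [smul_inv_smul] at hb'
  ext v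
  constructor
  · rintro ⟨v, hv, rfl⟩ hr
    apply hv
    have := reachable_smul g⁻¹ (hb'.trans hr)
    simpa only [map_inv_map, inv_smul_smul] using this
  · intro hv
    refine ⟨g⁻¹ • v, fun hr => hv ?_, smul_inv_smul _ _⟩
    have := reachable_smul g hr
    rw [smul_inv_smul] at this
    exact hb'.symm.trans this

/-- The element of `F` represented by a word. -/
def ofWord {w : Word} (h : IsPicture 1 w 1) : F := Diagram.mk ⟨w, h⟩

theorem ofWord_smul_base {w : Word} (h : IsPicture 1 w 1) : ofWord h • base = vertex h :=
  Sigma.ext rfl (heq_of_eq (Diagram.comp_id (Diagram.mk ⟨w, h⟩)))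

theorem inv_ofWord {w : Word} (h : IsPicture 1 w 1) : (ofWord h)⁻¹ = ofWord h.flip := rfl

theorem map_ofWord {w : Word} (h : IsPicture 1 w 1) (q : Point) :
    Diagram.map (ofWord h) q = Word.map w q := rfl

theorem translate_mem_of_smul_eq {P : Profile} {g : F} (hg : g • P = P) {A : Set Vertex}
    (hA : A ∈ P.carrier) (h : IsPosHalfSpace (translate g A)) : translate g A ∈ P.carrier := by
  have : translate g A ∈ (g • P).carrier := ⟨h, A, hA, h, subset_rfl⟩
  rwa [hg] at this

/-! ### Half-spaces in fixed profiles -/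

/-- The inverse of `u` turns the content `φ` into `φ'`. If `φ'` is not a prefix map, the vertex `u`
is not beyond the hyperplane, so the translate is positive and lies in the fixed profile. At a
vertex common to both half-spaces `φ` and `φ'` are standard. Their agreement at `y` and `z`, which
differ in the first letter, forces the same wire and prefix, hence `φ' = φ`. -/
theorem eq_or_standard_of_fixed {P : Profile} (hP : ∀ g : F, g • P = P) {e : Sym2 Vertex}
    (he : e ∈ skeleton.edgeSet) (hA : posHalf e ∈ P.carrier) {φ φ' : Stream' Bool → Stream' Bool}
    (hsep : Separates φ e) (hbad : ∀ c, caretEdge c ∉ hyperplane e) {u : Word}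
    (hu : IsPicture 1 u 1) (hφ' : ∀ x, Word.map u (0, φ x) = (0, φ' x)) {y z : Stream' Bool}
    (hyz : y.head ≠ z.head) (hy : φ' y = φ y) (hz : φ' z = φ z) :
    (∃ c : List Bool, ∀ x, φ' x = c ++ₛ x) ∨ φ' = φ := by
  by_contra! hcon
  obtain ⟨hns, hne⟩ := hcon
  have hstd : ∀ v ∈ posHalf e, StdAt φ v := fun v hv =>
    stdAt_of_mem_posHalf hsep (fun c _ => hbad c) hv
  have hmap : ∀ x, Diagram.map (ofWord hu)⁻¹ (0, φ' x) = (0, φ x) := fun x => by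
    rw [inv_ofWord, map_ofWord, ← hφ', Word.map_flip]
  have hbase : ((ofWord hu)⁻¹)⁻¹ • base ∉ posHalf e := by
    rw [inv_inv, ofWord_smul_base]
    intro hv
    obtain ⟨i, t, h⟩ := hstd _ hv
    obtain ⟨x, hx⟩ := hns t
    exact hx (congrArg Prod.snd ((hφ' x).symm.trans (h x)))
  have htr := translate_posHalf _ hbase
  have hmem : posHalf (e.map ((ofWord hu)⁻¹ • ·)) ∈ P.carrier := by
    rw [← htr]
    refine translate_mem_of_smul_eq (hP _) hA ?_
    rw [htr]
    exact ⟨_, map_smul_mem_edgeSet _ he, rfl⟩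
  obtain ⟨v, hv⟩ := P.inter {posHalf e, posHalf (e.map ((ofWord hu)⁻¹ • ·))} (by simp)
    (by rintro A (rfl | rfl); exacts [hA, hmem])
  obtain ⟨i, s, h1⟩ := hstd v (hv _ (by simp))
  -- For the translated hyperplane, the exclusion of carets is vacuous because `φ'` is not a prefix
  -- map.
  obtain ⟨j, t, h2⟩ := stdAt_of_mem_posHalf (separates_smul hmap hsep)
    (fun c hc => (hns c).elim fun x hx => absurd (hc x) hx) (hv _ (by simp))
  have h3 := (h1 y).symm.trans ((congrArg _ hy.symm).trans (h2 y))
  have h4 := (h1 z).symm.trans ((congrArg _ hz.symm).trans (h2 z))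
  obtain rfl : i = j := congrArg Prod.fst h3
  obtain rfl : s = t :=
    append_stream_cancel (congrArg Prod.snd h3) (congrArg Prod.snd h4) hyz
  exact hne (funext fun x => vertexMap_injective v ((h2 x).trans (h1 x).symm))

/-- A picture on the wire number `p` that represents a non-trivial element of `F`. -/
def rotation (p : ℕ) : Word := [⟨.split, p⟩, ⟨.split, p⟩, ⟨.merge, p + 1⟩, ⟨.merge, p⟩]

theorem isPicture_rotation (p r : ℕ) : IsPicture (p + 1 + r) (rotation p) (p + 1 + r) := by
  refine IsPicture.cons .split p r ?_
  have e : p + Kind.split.outs + r = p + Kind.split.ins + (r + 1) := by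
    simp only [Kind.ins, Kind.outs]; omega
  rw [e]
  refine .cons .split p (r + 1) ?_
  have e : p + Kind.split.outs + (r + 1) = p + 1 + Kind.merge.ins + r := by
    simp only [Kind.ins, Kind.outs]; omega
  rw [e]
  refine .cons .merge (p + 1) r ?_
  have e : p + 1 + Kind.merge.outs + r = p + Kind.merge.ins + r := by
    simp only [Kind.ins, Kind.outs]
  rw [e]
  exact .cons .merge p r (.nil _)

theorem map_rotation_of_ne {p j : ℕ} (h : j ≠ p) (x : Stream' Bool) :
    Word.map (rotation p) (j, x) = (j, x) := by
  rcases lt_or_gt_of_ne h with h | h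
  · simp only [rotation, Word.map_cons, Word.map_nil]
    rw [Atom.map_right _ h, Atom.map_right _ h, Atom.map_right _ (h.trans p.lt_succ_self),
      Atom.map_right _ h]
  · obtain ⟨r, rfl⟩ : ∃ r, j = p + 1 + r := ⟨j - (p + 1), by omega⟩
    have h1 : Atom.map ⟨.split, p⟩ (p + 1 + r, x) = (p + 2 + r, x) := Atom.map_left .split p r x
    have h2 : Atom.map ⟨.split, p⟩ (p + 1 + (r + 1), x) = (p + 2 + (r + 1), x) :=
      Atom.map_left .split p (r + 1) x
    have h3 : Atom.map ⟨.merge, p + 1⟩ (p + 1 + 2 + r, x) = (p + 1 + 1 + r, x) :=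
      Atom.map_left .merge (p + 1) r x
    have h4 : Atom.map ⟨.merge, p⟩ (p + 2 + r, x) = (p + 1 + r, x) := Atom.map_left .merge p r x
    simp only [rotation, Word.map_cons, Word.map_nil]
    rw [h1, show p + 2 + r = p + 1 + (r + 1) by omega, h2,
      show p + 2 + (r + 1) = p + 1 + 2 + r by omega, h3, show p + 1 + 1 + r = p + 2 + r by omega, h4]

theorem map_rotation (p : ℕ) (x : Stream' Bool) :
    Word.map (rotation p) (p, cons false (cons true x)) = (p, cons true (cons false x)) := by
  have h3 : Atom.map ⟨.merge, p + 1⟩ (p + 1, x) = (p + 1, cons false x) :=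
    Atom.map_merge (p + 1) false x
  have h4 : Atom.map ⟨.merge, p⟩ (p + 1, cons false x) = (p, cons true (cons false x)) :=
    Atom.map_merge p true _
  simp only [rotation, Word.map_cons, Word.map_nil]
  rw [Atom.map_split]
  simp only [Bool.toNat_false, add_zero]
  rw [Atom.map_split]
  simp only [Bool.toNat_true]
  rw [h3, h4]

/-- There is an element of `F` which is non-trivial below the address `ε`, and trivial elsewhere. -/
theorem exists_supported (ε : List Bool) :
    ∃ u : Word, IsPicture 1 u 1 ∧
      (∀ y : Stream' Bool, (∀ x, y ≠ ε ++ₛ x) → Word.map u (0, y) = (0, y)) ∧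
      ∃ x : Stream' Bool, Word.map u (0, ε ++ₛ x) ≠ (0, ε ++ₛ x) := by
  obtain ⟨s, hs, hp⟩ := isPicture_pathWord_aux 0 0 ε
  have hc := carries_pathWord_nil ε
  rw [zero_add, zero_add, add_zero] at hp
  -- This is the rotation conjugated by the path that makes the cone below `ε` a wire of its own.
  refine ⟨pathWord 0 ε ++ (rotation (ε.count true) ++ Word.flip (pathWord 0 ε)),
    hp.append ((isPicture_rotation _ _).append hp.flip), fun y hy => ?_,
    cons false (cons true (Stream'.const true)), fun h => ?_⟩
  · have hne : (Word.map (pathWord 0 ε) (0, y)).1 ≠ ε.count true := by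
      intro h
      refine hy (Word.map (pathWord 0 ε) (0, y)).2 ?_
      have h1 : Word.map (pathWord 0 ε) (0, y) =
          (ε.count true, (Word.map (pathWord 0 ε) (0, y)).2) := Prod.ext h rfl
      rw [← Stream'.nil_append_stream (Word.map (pathWord 0 ε) (0, y)).2, ← hc.map] at h1
      exact congrArg Prod.snd (Word.map_injective _ h1)
    rw [Word.map_append, Word.map_append]
    have := map_rotation_of_ne hne (Word.map (pathWord 0 ε) (0, y)).2
    rw [Prod.mk.eta] at this
    rw [this, Word.map_flip]
  · rw [Word.map_append, Word.map_append, hc.map, Stream'.nil_append_stream, map_rotation] at h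
    have h1 := congrArg (Word.map (pathWord 0 ε)) h
    rw [Word.map_flip', hc.map, Stream'.nil_append_stream] at h1
    have h2 := congrArg (fun q : Point => q.2.head) h1
    simp at h2

/-- Perturbing `φ` below a cone in `dd…` must yield a prefix map, so `φ` is a prefix map off that
cone. Since the cones for the two values of `d` are disjoint, `φ` is a prefix map everywhere,
although the perturbation was non-trivial. -/
theorem exists_caretEdge_of_fixed {P : Profile} (hP : ∀ g : F, g • P = P) {A : Set Vertex}
    (hA : A ∈ P.carrier) : ∃ c, A = posHalf (caretEdge c) := by
  by_contra! hcon
  obtain ⟨e, he, rfl⟩ := P.pos A hA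
  have hbad : ∀ c, caretEdge c ∉ hyperplane e := fun c hc => hcon c (posHalf_eq_of_mem hc).symm
  have hsplit : ∃ (w : Word) (i n n' : ℕ) (h : IsPicture 1 w n)
      (h' : IsPicture 1 (w ++ [⟨.split, i⟩]) n'), e = s(vertex h, vertex h') := by
    clear hcon hbad hA
    induction e using Sym2.ind with
    | _ a b => exact exists_split_of_adj he
  obtain ⟨w, i, n, n', hw, hw', hew⟩ := hsplit
  have hi : i < n := by
    obtain ⟨r, hr, -⟩ := hw.of_append_singleton_ins hw'
    simp only [Kind.ins] at hr
    omega
  -- `φ` inverts the matching given by `w` on the wire `i` to which the caret is attached.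
  obtain ⟨φ, hφ⟩ : ∃ φ : Stream' Bool → Stream' Bool,
      ∀ x, Word.map (Word.flip w) (i, x) = (0, φ x) :=
    ⟨fun x => (Word.map (Word.flip w) (i, x)).2, fun x => Prod.ext
      (by have := Word.map_fst_lt hw.flip (q := (i, x)) hi; simpa using this) rfl⟩
  have hφi : Function.Injective φ := fun x y hxy => by
    have h1 : Word.map (Word.flip w) (i, x) = Word.map (Word.flip w) (i, y) := by rw [hφ, hφ, hxy]
    exact congrArg Prod.snd (Word.map_injective _ h1)
  have hsep : Separates φ e := by
    rw [hew]
    refine separates_split hw hw' fun x => ?_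
    rw [← hφ, Word.map_flip']
  have key : ∀ d : Bool, ∃ c : List Bool,
      (∀ x : Stream' Bool, x.head = !d ∨ x.tail.head = !d → φ x = c ++ₛ x) ∧
        ¬ ∀ x, φ x = c ++ₛ x := by
    intro d
    -- The first two letters `d` leave room for test strings outside the cone with either first
    -- letter; the others make the cone small enough for its image under `φ` to be a cone `ε`.
    obtain ⟨j, ε, hε⟩ := exists_carries_of_length_le (w := Word.flip w) i
      (c := d :: d :: List.replicate (Word.flip w).length d) (by simp; omega)
    obtain rfl : j = 0 := by have := hε.lt hw.flip hi; omega
    have hε' : ∀ x, φ ((d :: d :: List.replicate (Word.flip w).length d) ++ₛ x) = ε ++ₛ x :=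
      fun x => congrArg Prod.snd ((hφ _).symm.trans (hε.map x))
    obtain ⟨u, hu, hu1, x₀, hu2⟩ := exists_supported ε
    obtain ⟨φ', hφ'⟩ : ∃ φ' : Stream' Bool → Stream' Bool,
        ∀ x, Word.map u (0, φ x) = (0, φ' x) :=
      ⟨fun x => (Word.map u (0, φ x)).2, fun x => Prod.ext
        (by have := Word.map_fst_lt hu (q := (0, φ x)) one_pos; simpa using this) rfl⟩
    have hout : ∀ x : Stream' Bool, x.head = !d ∨ x.tail.head = !d → φ' x = φ x := by
      intro x hx
      refine congrArg Prod.snd ((hφ' x).symm.trans (hu1 _ fun z hz => ?_))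
      rw [← hε'] at hz
      rw [hφi hz] at hx
      simp [Stream'.cons_append_stream, Stream'.tail_cons] at hx
    have hne : φ' ≠ φ := by
      rintro rfl
      refine hu2 ?_
      rw [← hε', hφ']
    -- Both test strings avoid `dd`, and their first letters differ.
    rcases eq_or_standard_of_fixed hP he hA hsep hbad hu hφ'
      (y := cons (!d) (Stream'.const d)) (z := cons d (Stream'.const (!d))) (by simp)
      (hout _ (.inl rfl)) (hout _ (.inr rfl)) with ⟨c, hc⟩ | h
    · refine ⟨c, fun x hx => by rw [← hout x hx, hc], fun h => hne ?_⟩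
      funext x
      rw [h, hc]
    · exact absurd h hne
  obtain ⟨c, hc, hnc⟩ := key false
  obtain ⟨c', hc', -⟩ := key true
  -- The strings `0111…` and `1000…` avoid both cones.
  obtain rfl : c = c' := by
    refine append_stream_cancel (x := cons false (Stream'.const true))
      (y := cons true (Stream'.const false)) ?_ ?_ (by simp)
    · rw [← hc _ (.inr rfl), hc' _ (.inl rfl)]
    · rw [← hc _ (.inl rfl), hc' _ (.inr rfl)]
  refine hnc fun x => ?_
  cases hx : x.head
  · exact hc' x (.inl hx)
  · exact hc x (.inl hx)

/-! ### Profiles of infinite trees -/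

theorem OfKind.intact_iff {w : Word} (hw : OfKind .split w) {n : ℕ} (h : IsPicture 1 w n)
    {b : List Bool} : Intact b (vertex h) ↔ Std fun x => Word.map w (0, b ++ₛ x) := by
  refine ⟨fun hi => hi.stdAt, fun hs => ?_⟩
  exact ⟨w, n, h, rfl, hw.exists_carries_of_std hs⟩

/-- A finite tree containing all the carets in question will do. Carets added later cannot make a
divided cone standard again, and in pictures without merging transistors standard cones are intact.
-/
theorem exists_mem_posHalf_of_finite {s : Set (Set Vertex)} (hs : s.Finite)
    (h : ∀ A ∈ s, ∃ b, A = posHalf (caretEdge b)) :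
    ∃ (w : Word) (n : ℕ) (hw : IsPicture 1 w n), OfKind .split w ∧ ∀ A ∈ s, vertex hw ∈ A := by
  induction s, hs using Set.Finite.induction_on with
  | empty => exact ⟨[], 1, .nil 1, by simp [OfKind], by simp⟩
  | @insert A s _ _ ih =>
    obtain ⟨w, n, hw, hsp, hmem⟩ := ih fun B hB => h B (Set.mem_insert_of_mem _ hB)
    obtain ⟨b, rfl⟩ := h A (Set.mem_insert _ _)
    by_cases hi : Intact b (vertex hw)
    · rw [hsp.intact_iff] at hi
      obtain ⟨i, t, hc⟩ := hsp.exists_carries_of_std hi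
      obtain ⟨r, rfl⟩ : ∃ r, n = i + 1 + r := ⟨n - (i + 1), by have := hc.lt hw one_pos; omega⟩
      obtain ⟨q, -, hp⟩ := isPicture_pathWord_aux i r t
      have hp' : IsPicture (i + 1 + r) (pathWord i t ++ [⟨.split, i + t.count true⟩]) _ :=
        IsPicture.append_singleton (k := .split) hp
      have hsp' : OfKind .split (pathWord i t ++ [⟨.split, i + t.count true⟩]) :=
        (ofKind_pathWord i t).append ofKind_singleton
      refine ⟨_, _, hw.append hp', hsp.append hsp', ?_⟩
      rintro B (rfl | hB)
      · rw [mem_posHalf_caretEdge, (hsp.append hsp').intact_iff]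
        have hp := carries_pathWord i t []
        rw [List.append_nil] at hp
        have := not_std_split (hc.append hp).map
        simp only [Word.map_append, Word.map_cons, Word.map_nil] at this ⊢
        exact this
      · obtain ⟨c, rfl⟩ := h B (Set.mem_insert_of_mem _ hB)
        have := hmem _ hB
        rw [mem_posHalf_caretEdge, hsp.intact_iff] at this
        rw [mem_posHalf_caretEdge, (hsp.append hsp').intact_iff]
        simp only [Word.map_append w]
        exact fun hstd => this (hsp'.std_of_std_map hstd)
    · refine ⟨w, n, hw, hsp, ?_⟩
      rintro B (rfl | hB)
      exacts [mem_posHalf_caretEdge.2 hi, hmem B hB]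

/-- A non-empty set of carets, closed under passing to carets above, in which no caret is the last
one on its branch. -/
structure IsTree (S : Set (List Bool)) : Prop where
  nonempty : S.Nonempty
  of_prefix : ∀ ⦃b c : List Bool⦄, c <+: b → b ∈ S → c ∈ S
  exists_append : ∀ b ∈ S, ∃ d, b ++ [d] ∈ S

/-- The profile of an infinite tree. -/
def IsTree.profile {S : Set (List Bool)} (hS : IsTree S) : Profile where
  carrier := treeHalfSpaces S
  pos := by
    rintro _ ⟨b, -, rfl⟩
    exact isPosHalfSpace_caretEdge b
  nonempty := hS.nonempty.image _
  inter s hs hsub := by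
    obtain ⟨w, n, hw, -, h⟩ := exists_mem_posHalf_of_finite hs fun A hA => by
      obtain ⟨b, -, rfl⟩ := hsub hA
      exact ⟨b, rfl⟩
    exact ⟨_, h⟩
  no_max := by
    rintro _ ⟨b, hb, rfl⟩
    obtain ⟨d, hd⟩ := hS.exists_append b hb
    refine ⟨_, ⟨_, hd, rfl⟩, posHalf_caretEdge_mono (List.prefix_append b [d]), fun h => ?_⟩
    have := (posHalf_caretEdge_subset_iff.1 h).length_le
    simp at this
  lower := by
    rintro _ ⟨b, hb, rfl⟩ B hB h
    obtain ⟨c, hc, rfl⟩ := exists_prefix_of_posHalf_subset hB h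
    exact ⟨c, hS.of_prefix hc hb, rfl⟩

theorem IsTree.exists_length_le {S : Set (List Bool)} (hS : IsTree S) {b : List Bool} (hb : b ∈ S)
    (N : ℕ) : ∃ c ∈ S, b <+: c ∧ N ≤ c.length := by
  induction N with
  | zero => exact ⟨b, hb, List.prefix_rfl, Nat.zero_le _⟩
  | succ N ih =>
    obtain ⟨c, hc, hbc, hN⟩ := ih
    obtain ⟨d, hd⟩ := hS.exists_append c hc
    exact ⟨_, hd, hbc.trans (List.prefix_append _ _), by simpa using hN⟩

/-! ### The action of `F` on the half-spaces of carets -/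

/-- Below `u`, the path to `b` makes the cone at the address `c` a whole wire. -/
theorem map_caretEdge_mem_hyperplane {u : Word} (hu : IsPicture 1 u 1) {b c : List Bool}
    (h : Carries u 0 c 0 b) :
    (caretEdge b).map (ofWord hu • ·) ∈ hyperplane (caretEdge c) := by
  have h1 := hu.append (isPicture_pathWord b)
  have h2 := hu.append (isPicture_caretWord b)
  have h3 : IsPicture 1 (u ++ pathWord 0 b ++ [⟨.split, b.count true⟩]) (b.length + 2) := by
    rw [List.append_assoc]; exact h2
  have key := crossesCaret_of_carries (h.append (carries_pathWord_nil b)) h1 h3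
  rw [vertex_congr h3 h2 (List.append_assoc _ _ _)] at key
  exact key

theorem translate_posHalf_caretEdge {u : Word} (hu : IsPicture 1 u 1) {b c : List Bool}
    (h : Carries u 0 c 0 b) :
    translate (ofWord hu) (posHalf (caretEdge b)) = posHalf (caretEdge c) := by
  rw [translate_posHalf, posHalf_eq_of_mem (map_caretEdge_mem_hyperplane hu h)]
  rw [inv_ofWord, ofWord_smul_base, mem_posHalf_caretEdge, not_not]
  exact ⟨_, _, hu.flip, rfl, 0, c, h.flip⟩

/-- Translates of caret half-spaces need not come from carets, but they do far enough down a branch: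
an address as long as the picture is carried to an address. Such half-spaces are cofinal because
branches of `S` do not end. -/
theorem IsTree.smul_subset {S : Set (List Bool)} (hS : IsTree S)
    (hc : ∀ u, IsPicture 1 u 1 → ∀ b ∈ S, ∀ c, Carries u 0 b 0 c → c ∈ S) (g : F) :
    (g • hS.profile).carrier ⊆ hS.profile.carrier := by
  induction g using Quotient.ind with
  | _ Q =>
    obtain ⟨u, hu⟩ := Q
    rintro B ⟨hB, _, ⟨b, hb, rfl⟩, -, hsub⟩
    obtain ⟨b', hb', hbb', hlen⟩ := hS.exists_length_le hb (Word.flip u).length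
    obtain ⟨i, c, hcar⟩ := exists_carries_of_length_le 0 hlen
    obtain rfl : i = 0 := by have := hcar.lt hu.flip one_pos; omega
    refine hS.profile.lower _ ⟨c, hc _ hu.flip _ hb' _ hcar, rfl⟩ B hB ?_
    refine subset_trans ?_ hsub
    dsimp only
    rw [← translate_posHalf_caretEdge hu (by simpa only [Word.flip_flip] using hcar.flip)]
    exact translate_mono _ (posHalf_caretEdge_mono hbb')

theorem IsTree.smul_eq {S : Set (List Bool)} (hS : IsTree S)
    (hc : ∀ u, IsPicture 1 u 1 → ∀ b ∈ S, ∀ c, Carries u 0 b 0 c → c ∈ S) (g : F) :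
    g • hS.profile = hS.profile := by
  refine Profile.ext (Set.Subset.antisymm (hS.smul_subset hc g) fun B hB => ?_)
  rw [← smul_inv_smul g hS.profile] at hB
  obtain ⟨h1, A, hA, h2⟩ := hB
  exact ⟨h1, A, hS.smul_subset hc g⁻¹ hA, h2⟩

/-- The two leftmost wires are merged as long as at least two wires lie to the left of the marked
one. -/
theorem exists_slide_left (l r : ℕ) : ∃ w, IsPicture (l + 1 + r) w (min l 1 + 1 + r) ∧
    ∀ c, Carries w l c (min l 1) c := by
  induction l with
  | zero => exact ⟨[], .nil _, fun c => .nil _ _⟩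
  | succ l ih =>
    obtain _ | l := l
    · exact ⟨[], .nil _, fun c => .nil _ _⟩
    · obtain ⟨w, hw, hc⟩ := ih
      rw [Nat.min_eq_right (by omega)] at hw hc ⊢
      refine ⟨⟨.merge, 0⟩ :: w, ?_, fun c => ?_⟩
      · have := IsPicture.cons .merge 0 (l + 1 + r) (w := w) (n := 1 + 1 + r)
          (by convert hw using 1; simp only [Kind.outs]; omega)
        convert this using 1
        simp only [Kind.ins]; omega
      · have := Carries.left .merge 0 l (w := w) (c := c) (i := 1) (t := c)
          (by convert hc c using 1; simp only [Kind.outs]; omega)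
        convert this using 1
        simp only [Kind.ins]; omega

theorem exists_slide_right (l r : ℕ) : ∃ w, IsPicture (l + 1 + r) w (l + 1 + min r 1) ∧
    ∀ c, Carries w l c l c := by
  induction r with
  | zero => exact ⟨[], .nil _, fun c => .nil _ _⟩
  | succ r ih =>
    obtain _ | r := r
    · exact ⟨[], .nil _, fun c => .nil _ _⟩
    · obtain ⟨w, hw, hc⟩ := ih
      rw [Nat.min_eq_right (by omega)] at hw ⊢
      refine ⟨⟨.merge, l + 1⟩ :: w, ?_, fun c => .right .merge l.lt_succ_self (hc c)⟩
      have := IsPicture.cons .merge (l + 1) r (w := w) (n := l + 1 + 1)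
        (by convert hw using 1; simp only [Kind.outs]; omega)
      convert this using 1
      simp only [Kind.ins]; omega

/-- Merging everything on each side of the wire of `b` leaves a row that depends only on which sides
are empty. Two such pictures with equal rows can be glued along them. -/
theorem exists_isolating_picture (b : List Bool) :
    ∃ w, IsPicture 1 w (min (b.count true) 1 + 1 + min (b.count false) 1) ∧
      Carries w 0 b (min (b.count true) 1) [] := by
  obtain ⟨s, hs, hp⟩ := isPicture_pathWord_aux 0 0 b
  have hlen : b.count true + b.count false = b.length := List.count_true_add_count_false b
  obtain rfl : s = b.count false := by omega
  rw [zero_add, zero_add, add_zero] at hp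
  obtain ⟨w, hw, hwc⟩ := exists_slide_left (b.count true) (b.count false)
  obtain ⟨w', hw', hwc'⟩ := exists_slide_right (min (b.count true) 1) (b.count false)
  exact ⟨_, (hp.append hw).append hw',
    ((carries_pathWord_nil b).append (hwc [])).append (hwc' [])⟩

theorem min_count_eq {d : Bool} {b c : List Bool} (h : d ∈ b ↔ d ∈ c) :
    min (b.count d) 1 = min (c.count d) 1 := by
  rw [← List.count_pos_iff, ← List.count_pos_iff] at h
  omega

/-- Two carets that touch the same sides of the full tree are related by an element of `F`. -/
theorem exists_carries {b c : List Bool} (ht : true ∈ b ↔ true ∈ c) (hf : false ∈ b ↔ false ∈ c) :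
    ∃ u, IsPicture 1 u 1 ∧ Carries u 0 c 0 b := by
  obtain ⟨w, hw, hwc⟩ := exists_isolating_picture b
  obtain ⟨w', hw', hwc'⟩ := exists_isolating_picture c
  rw [← min_count_eq ht, ← min_count_eq hf] at hw'
  rw [← min_count_eq ht] at hwc'
  exact ⟨_, hw'.append hw.flip, hwc'.append hwc.flip⟩

/-! ### The four trees -/

theorem mem_leftComb {b : List Bool} : b ∈ leftComb ↔ true ∉ b := by
  constructor
  · rintro ⟨k, rfl⟩
    simp [List.mem_replicate]
  · intro h
    refine ⟨b.length, List.eq_replicate_iff.2 ⟨rfl, fun d hd => ?_⟩⟩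
    cases d
    exacts [rfl, absurd hd h]

theorem mem_rightComb {b : List Bool} : b ∈ rightComb ↔ false ∉ b := by
  constructor
  · rintro ⟨k, rfl⟩
    simp [List.mem_replicate]
  · intro h
    refine ⟨b.length, List.eq_replicate_iff.2 ⟨rfl, fun d hd => ?_⟩⟩
    cases d
    exacts [absurd hd h, rfl]

theorem isTree_leftComb : IsTree leftComb where
  nonempty := ⟨[], mem_leftComb.2 (by simp)⟩
  of_prefix b c h hb := by
    rw [mem_leftComb] at hb ⊢
    exact fun hc => hb (h.subset hc)
  exists_append b hb := ⟨false, by rw [mem_leftComb] at hb ⊢; simpa using hb⟩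

theorem isTree_rightComb : IsTree rightComb where
  nonempty := ⟨[], mem_rightComb.2 (by simp)⟩
  of_prefix b c h hb := by
    rw [mem_rightComb] at hb ⊢
    exact fun hc => hb (h.subset hc)
  exists_append b hb := ⟨true, by rw [mem_rightComb] at hb ⊢; simpa using hb⟩

theorem IsTree.union {S T : Set (List Bool)} (hS : IsTree S) (hT : IsTree T) : IsTree (S ∪ T) where
  nonempty := hS.nonempty.inl
  of_prefix _ _ h hb := hb.imp (hS.of_prefix h) (hT.of_prefix h)
  exists_append b hb := by
    rcases hb with hb | hb
    · exact (hS.exists_append b hb).imp fun _ => .inl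
    · exact (hT.exists_append b hb).imp fun _ => .inr

theorem isTree_univ : IsTree Set.univ where
  nonempty := Set.univ_nonempty
  of_prefix _ _ _ _ := trivial
  exists_append _ _ := ⟨true, trivial⟩

theorem Kind.one_le_ins (k : Kind) : 1 ≤ k.ins := by cases k <;> simp [Kind.ins]

/-- The left end of the leftmost wire remains the left end of the leftmost wire. -/
theorem Carries.leftComb {w : Word} {j i : ℕ} {c t : List Bool} (h : Carries w j c i t)
    (hj : j = 0) (hc : true ∉ c) : i = 0 ∧ true ∉ t := by
  induction h with
  | nil => exact ⟨hj, hc⟩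
  | left k p r _ ih => have := k.one_le_ins; omega
  | right k _ _ ih => exact ih hj hc
  | split j d _ ih =>
    cases d
    · exact ih hj (by simpa using hc)
    · simp at hc
  | merge j d _ ih =>
    cases d
    · exact ih hj (by simpa using hc)
    · simp at hj

/-- The mirror statement needs the widths, to know which wire is the last. -/
theorem Carries.rightComb {w : Word} {j i : ℕ} {c t : List Bool} (h : Carries w j c i t)
    {m n : ℕ} (hw : IsPicture m w n) (hj : j + 1 = m) (hc : false ∉ c) : false ∉ t := by
  induction h generalizing m with
  | nil => exact hc
  | left k p r _ ih =>
    obtain ⟨s, e, hw⟩ := hw.of_cons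
    exact ih hw (by dsimp only at e ⊢; omega) hc
  | right k h _ ih =>
    obtain ⟨s, e, hw⟩ := hw.of_cons
    have := k.one_le_ins
    dsimp only at e
    omega
  | split j d _ ih =>
    obtain ⟨s, e, hw⟩ := hw.of_cons
    cases d
    · simp at hc
    · exact ih hw (by simp only [Kind.ins, Kind.outs, Bool.toNat_true] at e ⊢; omega)
        (by simpa using hc)
  | merge j d _ ih =>
    obtain ⟨s, e, hw⟩ := hw.of_cons
    cases d
    · simp only [Kind.ins, Bool.toNat_false] at e hj
      omega
    · exact ih hw (by simp only [Kind.ins, Kind.outs, Bool.toNat_true] at e hj ⊢; omega)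
        (by simpa using hc)

theorem leftComb_closed {u : Word} {b c : List Bool} (hb : b ∈ leftComb)
    (h : Carries u 0 b 0 c) : c ∈ leftComb :=
  mem_leftComb.2 (h.leftComb rfl (mem_leftComb.1 hb)).2

theorem rightComb_closed {u : Word} (hu : IsPicture 1 u 1) {b c : List Bool} (hb : b ∈ rightComb)
    (h : Carries u 0 b 0 c) : c ∈ rightComb :=
  mem_rightComb.2 (h.rightComb hu rfl (mem_rightComb.1 hb))

/-- The trees that contain, along with a caret, all carets touching the same sides of the full
tree. -/
theorem IsTree.eq_of_forall_mem {S : Set (List Bool)} (hS : IsTree S)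
    (h : ∀ b ∈ S, ∀ c, (true ∈ b ↔ true ∈ c) → (false ∈ b ↔ false ∈ c) → c ∈ S) :
    S = leftComb ∨ S = rightComb ∨ S = leftComb ∪ rightComb ∨ S = Set.univ := by
  by_cases hboth : ∃ b ∈ S, true ∈ b ∧ false ∈ b
  · obtain ⟨b, hb, ht, hf⟩ := hboth
    refine .inr (.inr (.inr (Set.eq_univ_of_forall fun c => ?_)))
    -- With both letters appended, the caret touches neither side, like `b`, and it lies below the
    -- arbitrary caret `c`.
    exact hS.of_prefix (List.prefix_append c [true, false])
      (h b hb _ (by simp [ht]) (by simp [hf]))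
  push Not at hboth
  have hsub : S ⊆ leftComb ∪ rightComb := fun b hb => by
    rw [Set.mem_union, mem_leftComb, mem_rightComb]
    exact or_iff_not_imp_left.2 fun ht => hboth b hb (not_not.1 ht)
  have hnil : [] ∈ S := hS.nonempty.elim fun b hb => hS.of_prefix List.nil_prefix hb
  have hL : [false] ∈ S → leftComb ⊆ S := fun hm b hb => by
    rw [mem_leftComb] at hb
    -- The extra letter is for `b = []`, which touches both sides while `[false]` touches only the
    -- left one.
    refine hS.of_prefix (List.prefix_append b [false]) (h _ hm _ ?_ ?_) <;> simp [hb]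
  have hR : [true] ∈ S → rightComb ⊆ S := fun hm b hb => by
    rw [mem_rightComb] at hb
    refine hS.of_prefix (List.prefix_append b [true]) (h _ hm _ ?_ ?_) <;> simp [hb]
  have hL' : [false] ∉ S → S ⊆ rightComb := fun hm b hb => by
    rcases hsub hb with hb' | hb'
    · rw [mem_leftComb] at hb'
      rw [mem_rightComb]
      exact fun hf => hm (h b hb _ (by simp [hb']) (by simp [hf]))
    · exact hb'
  have hR' : [true] ∉ S → S ⊆ leftComb := fun hm b hb => by
    rcases hsub hb with hb' | hb'
    · exact hb'
    · rw [mem_rightComb] at hb'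
      rw [mem_leftComb]
      exact fun ht => hm (h b hb _ (by simp [ht]) (by simp [hb']))
  by_cases hf : [false] ∈ S <;> by_cases ht : [true] ∈ S
  · exact .inr (.inr (.inl (hsub.antisymm (Set.union_subset (hL hf) (hR ht)))))
  · exact .inl ((hR' ht).antisymm (hL hf))
  · exact .inr (.inl ((hL' hf).antisymm (hR ht)))
  -- The root alone is not a tree without last carets.
  · obtain ⟨d, hd⟩ := hS.exists_append [] hnil
    cases d
    exacts [absurd hd hf, absurd hd ht]

/-! ### Classification of the fixed profiles -/

/-- A profile which is fixed by `F` is the profile of one of the four trees. -/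
theorem carrier_eq_of_fixed {P : Profile} (hP : ∀ g : F, g • P = P) :
    P.carrier = treeHalfSpaces leftComb ∨ P.carrier = treeHalfSpaces rightComb ∨
      P.carrier = treeHalfSpaces (leftComb ∪ rightComb) ∨
      P.carrier = treeHalfSpaces Set.univ := by
  let S : Set (List Bool) := {b | posHalf (caretEdge b) ∈ P.carrier}
  have hcar : P.carrier = treeHalfSpaces S := by
    ext A
    constructor
    · intro hA
      obtain ⟨c, rfl⟩ := exists_caretEdge_of_fixed hP hA
      exact ⟨c, hA, rfl⟩
    · rintro ⟨b, hb, rfl⟩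
      exact hb
  have hS : IsTree S :=
    { nonempty := by
        obtain ⟨A, hA⟩ := P.nonempty
        obtain ⟨c, rfl⟩ := exists_caretEdge_of_fixed hP hA
        exact ⟨c, hA⟩
      of_prefix := fun b c h hb =>
        P.lower _ hb _ (isPosHalfSpace_caretEdge c) (posHalf_caretEdge_mono h)
      exists_append := fun b hb => by
        obtain ⟨B, hB, hBb⟩ := P.no_max _ hb
        obtain ⟨c, rfl⟩ := exists_caretEdge_of_fixed hP hB
        obtain ⟨s, rfl⟩ := posHalf_caretEdge_subset_iff.1 hBb.1
        cases s with
        | nil => exact absurd (by rw [List.append_nil]) hBb.2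
        | cons d s =>
          exact ⟨d, P.lower _ hB _ (isPosHalfSpace_caretEdge _)
            (posHalf_caretEdge_mono ⟨s, by simp⟩)⟩ }
  have h := hS.eq_of_forall_mem fun b hb c ht hf => by
    obtain ⟨u, hu, hc⟩ := exists_carries ht hf
    have htr := translate_posHalf_caretEdge hu hc
    have := translate_mem_of_smul_eq (hP (ofWord hu)) hb (htr ▸ isPosHalfSpace_caretEdge c)
    rwa [htr] at this
  rw [hcar]
  exact h.imp (congrArg _) (Or.imp (congrArg _) (Or.imp (congrArg _) (congrArg _)))

theorem treeHalfSpaces_injective : Function.Injective treeHalfSpaces :=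
  Set.image_injective.2 posHalf_caretEdge_injective

end ThompsonProfile

open ThompsonProfile in
theorem theorem5p1 :
    ∃ ΔL ΔR ΔLR Δinf : ThompsonProfile.Profile,
      ΔL.carrier = ThompsonProfile.treeHalfSpaces ThompsonProfile.leftComb ∧
      ΔR.carrier = ThompsonProfile.treeHalfSpaces ThompsonProfile.rightComb ∧
      ΔLR.carrier = ThompsonProfile.treeHalfSpaces
        (ThompsonProfile.leftComb ∪ ThompsonProfile.rightComb) ∧
      Δinf.carrier = ThompsonProfile.treeHalfSpaces Set.univ ∧
      [ΔL, ΔR, ΔLR, Δinf].Nodup ∧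
      MulAction.fixedPoints ThompsonProfile.F ThompsonProfile.Profile =
        {ΔL, ΔR, ΔLR, Δinf} := by
  refine ⟨isTree_leftComb.profile, isTree_rightComb.profile,
    (isTree_leftComb.union isTree_rightComb).profile, isTree_univ.profile, rfl, rfl, rfl, rfl,
    ?_, ?_⟩
  · have hne : ∀ {S T : Set (List Bool)} (hS : IsTree S) (hT : IsTree T) (b : List Bool),
        (b ∈ S ∧ b ∉ T ∨ b ∉ S ∧ b ∈ T) → hS.profile ≠ hT.profile := by
      intro S T hS hT b hb h
      have : S = T := treeHalfSpaces_injective (congrArg Profile.carrier h)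
      rw [this] at hb
      tauto
    -- The carets `[true]` and `[false]` lie on one comb each, and `[true, false]` on neither.
    have h1 := hne isTree_leftComb isTree_rightComb [true]
      (by simp [mem_leftComb, mem_rightComb])
    have h2 := hne isTree_leftComb (isTree_leftComb.union isTree_rightComb) [true]
      (by simp [mem_leftComb, mem_rightComb])
    have h3 := hne isTree_leftComb isTree_univ [true] (by simp [mem_leftComb])
    have h4 := hne isTree_rightComb (isTree_leftComb.union isTree_rightComb) [false]
      (by simp [mem_leftComb, mem_rightComb])
    have h5 := hne isTree_rightComb isTree_univ [false] (by simp [mem_rightComb])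
    have h6 := hne (isTree_leftComb.union isTree_rightComb) isTree_univ [true, false]
      (by simp [mem_leftComb, mem_rightComb])
    simp [h1, h2, h3, h4, h5, h6]
  · ext P
    simp only [MulAction.mem_fixedPoints, Set.mem_insert_iff, Set.mem_singleton_iff]
    constructor
    · intro hP
      exact (carrier_eq_of_fixed hP).imp Profile.ext
        (Or.imp Profile.ext (Or.imp Profile.ext Profile.ext))
    · rintro (rfl | rfl | rfl | rfl)
      · exact isTree_leftComb.smul_eq fun u _ b hb c h => leftComb_closed hb h
      · exact isTree_rightComb.smul_eq fun u hu b hb c h => rightComb_closed hu hb h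
      · refine IsTree.smul_eq _ fun u hu b hb c h => ?_
        exact hb.imp (fun hb => leftComb_closed hb h) fun hb => rightComb_closed hu hb h
      · exact isTree_univ.smul_eq fun _ _ _ _ _ _ => trivial
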